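/- Let $\mathcal S^\sharp$ be the extended Selberg class: the functions $F\not\equiv 0$ such that $F(s)=\sum_{n\ge1}a(n)n^{-s}$ converges absolutely for $\Re(s)>1$; for some integer $m\ge0$ the function $(s-1)^mF(s)$ extends to an entire function of finite order; and $\Phi(s)=\omega\,\overline{\Phi(1-\overline{s})}$ as meromorphic functions, where $\Phi(s)=Q^s\prod_{j=1}^r\Gamma(\lambda_js+\mu_j)F(s)$ with $Q>0$, $\lambda_j>0$, $\Re(\mu_j)\ge0$ and $|\omega|=1$. The degree of $F$ is $d=2\sum_j\lambda_j$. **Theorem (trivial zeros).** Let $F\in\mathcal S^\sharp$ have degree $1$ and let $\alpha\in\mathbb R$. The linear twist, defined for $\Re(s)>1$ by $$F(s,\alpha)=\sum_{n=1}^\infty\frac{a(n)}{n^s}e^{-2\pi i n\alpha},$$ has a meromorphic continuation to $\mathbb C$, and there exist $A,B\in\mathbb C$ with $\Re(A)<0$ and $\Re(B)<0$, and a real number $0<\eta<1$, such that, with $s_h=Ah+B$, for every integer $h\ge0$ the function $F(s,\alpha)$ is holomorphic and has exactly one zero, counted with multiplicity, inside the circle $C_h$ of centre $s_h$ and radius $\eta^{-\Re(s_h)}$.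 In particular there are infinitely many such circles. -/

import Mathlib

open Complex ComplexConjugate

noncomputable section

/-- The data `(Q, λ₁, …, λᵣ, μ₁, …, μᵣ)` of a gamma factor
`γ(s) = Q ^ s * ∏ⱼ Γ(λⱼ s + μⱼ)` with `Q > 0`, `λⱼ > 0` and `Re μⱼ ≥ 0`. -/
structure GammaFactor where
  r : ℕ
  Q : ℝ
  lam : Fin r → ℝ
  mu : Fin r → ℂ
  Q_pos : 0 < Q
  lam_pos : ∀ j, 0 < lam j
  mu_re_nonneg : ∀ j, 0 ≤ (mu j).re

/-- The gamma factor `γ(s) = Q ^ s * ∏ⱼ Γ(λⱼ s + μⱼ)` as a function. -/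
def GammaFactor.eval (g : GammaFactor) (s : ℂ) : ℂ :=
  (g.Q : ℂ) ^ s * ∏ j, Complex.Gamma ((g.lam j : ℂ) * s + g.mu j)

/-- `s` is not a pole of any of the factors `Γ(λⱼ s + μⱼ)`. -/
def GammaFactor.RegularAt (g : GammaFactor) (s : ℂ) : Prop :=
  ∀ (j : Fin g.r) (n : ℕ), (g.lam j : ℂ) * s + g.mu j ≠ -(n : ℂ)

/-- The degree `d = 2 ∑ⱼ λⱼ`. -/
def GammaFactor.degree (g : GammaFactor) : ℝ := 2 * ∑ j, g.lam j

/-- The conjugate function: the value at `s` is the conjugate of `Φ (conj s)`. -/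
def conjFun (Φ : ℂ → ℂ) (s : ℂ) : ℂ := conj (Φ (conj s))

/-- The functional equation `Φ(s) = ω * (conjFun Φ)(1 - s)` with `Φ = γ F`. It is an identity of
meromorphic functions, written at every `s` such that neither `s` nor the reflected point
`conj (1 - s)` is a pole of a gamma function or the possible pole `1` of `F`. -/
def SatisfiesFunctionalEquation (g : GammaFactor) (ω : ℂ) (F : ℂ → ℂ) : Prop :=
  ∀ s : ℂ, s ≠ 0 → s ≠ 1 → g.RegularAt s → g.RegularAt (conj (1 - s)) →
    g.eval s * F s = ω * conjFun (fun w => g.eval w * F w) (1 - s)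

/-- An entire function of finite order. -/
def IsEntireOfFiniteOrder (E : ℂ → ℂ) : Prop :=
  Differentiable ℂ E ∧
    ∃ ρ C : ℝ, 0 < ρ ∧ ∀ s : ℂ, ‖E s‖ ≤ C * Real.exp (‖s‖ ^ ρ)

/-- `F`, with Dirichlet coefficients `a(n)`, `n ≥ 1`, is an element of degree `d` of the extended
Selberg class. The value of `F` at the possible pole `s = 1` plays no role. -/
structure IsExtendedSelberg (d : ℝ) (a : ℕ → ℂ) (F : ℂ → ℂ) : Prop where
  /-- The Dirichlet series converges absolutely for `Re s > 1`. -/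
  summable : ∀ s : ℂ, 1 < s.re → LSeriesSummable a s
  /-- `F` is the sum of the Dirichlet series for `Re s > 1`. -/
  eq_LSeries : ∀ s : ℂ, 1 < s.re → F s = LSeries a s
  /-- `F` is not identically zero. -/
  ne_zero : ∃ s : ℂ, 1 < s.re ∧ F s ≠ 0
  /-- For some `m`, `(s - 1) ^ m * F s` continues to an entire function of finite order. -/
  continuation : ∃ (m : ℕ) (E : ℂ → ℂ), IsEntireOfFiniteOrder E ∧
    ∀ s : ℂ, s ≠ 1 → E s = (s - 1) ^ m * F s
  /-- The functional equation, with a gamma factor of degree `d`. -/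
  functional_equation : ∃ (g : GammaFactor) (ω : ℂ), ‖ω‖ = 1 ∧ g.degree = d ∧
    SatisfiesFunctionalEquation g ω F

/-- The Dirichlet coefficients `a(n) e(-n α)`, `e(x) = exp(2 π i x)`, of the linear twist. -/
def twistCoeff (a : ℕ → ℂ) (α : ℝ) (n : ℕ) : ℂ :=
  a n * Complex.exp (2 * Real.pi * Complex.I * (-(n : ℂ) * (α : ℂ)))

/-- `G` is a meromorphic continuation to `ℂ` of the linear twist
`F(s, α) = ∑ a(n) e(-n α) / n ^ s`, `Re s > 1`; it is unique where it is analytic. -/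
def IsLinearTwist (a : ℕ → ℂ) (α : ℝ) (G : ℂ → ℂ) : Prop :=
  MeromorphicOn G Set.univ ∧ ∀ s : ℂ, 1 < s.re → G s = LSeries (twistCoeff a α) s

/-- `G` is analytic inside the circle of centre `c` and radius `R` and has there exactly one zero,
counted with multiplicity. -/
def HasExactlyOneZeroInside (G : ℂ → ℂ) (c : ℂ) (R : ℝ) : Prop :=
  AnalyticOnNhd ℂ G (Metric.ball c R) ∧
    ∃ z ∈ Metric.ball c R, analyticOrderAt G z = 1 ∧
      ∀ w ∈ Metric.ball c R, G w = 0 → w = z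

end

/-!
An element of degree `1` of the extended Selberg class is, up to a shift `s ↦ s - iθ`, a Dirichlet
series with periodic coefficients. Once this is known, the twist is a finite combination of periodic
zeta functions, and its functional equation shows where it vanishes far to the left.

**Periodicity.** Consider `f(z) = ∑ a(n) exp (-n z)` for `Re z > 0`. It is the inverse Mellin
transform of `Γ(w) F(w)` (`IsExtendedSelberg.tsum_exp_eq_integral`). Let `z` tend to a point `i c` of
the positive imaginary axis. The lower part of the line of integration contributes a bounded
amount, and the part above a fixed height is moved from `Re w = 2` to `Re w = -1`, where no pole is
met (`IsExtendedSelberg.integral_Ioi_mellinIntegrand`); the growth of `F` needed for this comes from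
the Phragmén–Lindelöf principle. On `Re w = -1` the functional equation applies. By Stirling's
formula, the kernel `Γ(w) γ*(1 - w) / γ(w)`, `w = -1 + it`, of a gamma factor of degree `1` is
asymptotic to a constant times `t ^ (iθ) exp (-πt/2 - iρt)`
(`GammaFactor.hasStirlingForm_kernel`): degree `1` is exactly what makes the powers `t ^ t` cancel
against those of `Γ(w)`. So `f` becomes a series of Laplace integrals of `t ^ (iθ) exp (i x t)`
with `x = log n - log c - ρ`, and only the term with `x = 0`, if there is one, is as large as the
reciprocal of the distance of `z` to the axis. Hence the normalised limit of `f` at `i c` is a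
multiple of `n ^ (iθ) conj (a n)` if `c exp ρ` is a positive integer `n`, and zero otherwise
(`IsExtendedSelberg.tendsto_tsum_exp`). But `f` has period `2πi`. Therefore `N = 2π exp ρ` is an
integer and `a(n) n ^ (-iθ)` has period `N` (`IsExtendedSelberg.exists_periodic`).

**Zeros.** A finite Fourier expansion gives the twist as a combination of the functions `expZeta` of
Mathlib, at the frequencies `j / N - α` modulo `1` (`periodicTwist`). At `s = 1 + iθ - w`, its
functional equation expresses it through `exp (πiw/2) D₁(w) + exp (-πiw/2) D₂(w)`, where `D₁`, `D₂`
are combinations of Hurwitz zeta functions. As `Re w → ∞` these are `C₁ x ^ (-w)` and `C₂ y ^ (-w)`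
up to exponentially small relative errors, `C₁`, `C₂` being nonzero and `x`, `y` the smallest
positive frequencies in the two directions (`exists_isExpSmall_sum_hurwitzZeta`). The two main terms
cancel on an arithmetic progression of step `2πi / Λ` in `w`, `Λ = πi - log x + log y`, and
`Re (2πi / Λ) = 2π² / |Λ|²` is positive. Near each of its points the twist is a nonvanishing
function times a small perturbation of `exp (-Λ (s - s_h)) - 1`, which has exactly one zero in a
disc a little larger than the perturbation (`exists_hasExactlyOneZeroInside_exp_sub_one_add`).
-/

/-! ### Stirling's formula on vertical lines -/

/-- The error term `(s + 1/2) log (1 + 1/s) - 1` by which `s ↦ (s - 1/2) log s - s` fails to satisfy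
the functional equation of `log Γ`. -/
noncomputable def binetTerm (s : ℂ) : ℂ := (s + 1 / 2) * Complex.log (1 + 1 / s) - 1

/-- The main factor `exp ((s - 1/2) log s - s)` of Stirling's formula. -/
noncomputable def stirlingMain (s : ℂ) : ℂ := Complex.exp ((s - 1 / 2) * Complex.log s - s)

lemma norm_binetTerm_le {s : ℂ} (hs : 2 ≤ ‖s‖) : ‖binetTerm s‖ ≤ 2 / ‖s‖ ^ 2 := by
  have hs0 : s ≠ 0 := by
    rintro rfl; norm_num at hs
  set z : ℂ := 1 / s with hz
  have hsz : s = 1 / z := by simp [hz]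
  have hz0 : z ≠ 0 := by simp [hz, hs0]
  have hzn : ‖z‖ ≤ 1 / 2 := by
    rw [hz, norm_div, norm_one]
    exact one_div_le_one_div_of_le two_pos hs
  have hzpos : 0 < ‖z‖ := norm_pos_iff.2 hz0
  have h := Complex.norm_log_sub_logTaylor_le 2 (z := z) (by linarith)
  set R := Complex.log (1 + z) - Complex.logTaylor (2 + 1) z with hR
  have hT : Complex.logTaylor (2 + 1) z = z - z ^ 2 / 2 := by
    simp [Complex.logTaylor, Finset.sum_range_succ]
    ring
  have hb : binetTerm s = -z ^ 2 / 4 + R / z + R / 2 := by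
    have : Complex.log (1 + z) = z - z ^ 2 / 2 + R := by rw [hR, hT]; ring
    rw [binetTerm, ← hz, this, hsz]
    field_simp
    ring
  have hR' : ‖R‖ ≤ ‖z‖ ^ 3 * (2 / 3) := by
    refine h.trans ?_
    have : (1 - ‖z‖)⁻¹ ≤ 2 := by
      rw [inv_le_comm₀ (by linarith) two_pos]; norm_num; linarith
    have h3 : 0 ≤ ‖z‖ ^ 3 := by positivity
    norm_num
    nlinarith [mul_le_mul_of_nonneg_left this h3]
  have h1 : ‖R / z‖ ≤ ‖z‖ ^ 2 * (2 / 3) := by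
    rw [norm_div, div_le_iff₀ hzpos]
    calc _ ≤ _ := hR'
      _ = _ := by ring
  have h2 : ‖R / 2‖ ≤ ‖z‖ ^ 2 * (1 / 6) := by
    rw [norm_div, Complex.norm_two]
    have : ‖z‖ ^ 3 ≤ ‖z‖ ^ 2 * (1 / 2) := by
      rw [pow_succ]; gcongr
    linarith
  have h3 : ‖-z ^ 2 / 4‖ = ‖z‖ ^ 2 / 4 := by simp
  have h4 : 2 / ‖s‖ ^ 2 = 2 * ‖z‖ ^ 2 := by
    rw [hz, norm_div, norm_one]; field_simp
  rw [hb, h4]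
  calc _ ≤ ‖-z ^ 2 / 4‖ + ‖R / z‖ + ‖R / 2‖ := norm_add₃_le
    _ ≤ _ := by rw [h3]; nlinarith [sq_nonneg ‖z‖]

lemma log_add_one_of_im_pos {s : ℂ} (hs : 0 < s.im) :
    Complex.log (s + 1) = Complex.log s + Complex.log (1 + 1 / s) := by
  have hs0 : s ≠ 0 := by
    rintro rfl; simp at hs
  have him : (1 + 1 / s).im < 0 := by
    simp only [one_div, Complex.add_im, Complex.one_im, Complex.inv_im, zero_add]
    exact div_neg_of_neg_of_pos (by linarith) (Complex.normSq_pos.2 hs0)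
  have h1 : 1 + 1 / s ≠ 0 := by
    intro h; rw [h] at him; simp at him
  rw [← Complex.log_mul hs0 h1]
  · congr 1; field_simp
  · have ha := Complex.arg_nonneg_iff.2 hs.le
    have hb := Complex.arg_neg_iff.2 him
    have hc := Complex.neg_pi_lt_arg (1 + 1 / s)
    have hd := Complex.arg_le_pi s
    constructor <;> linarith

lemma stirlingMain_add_one {s : ℂ} (hs : 0 < s.im) :
    stirlingMain (s + 1) = stirlingMain s * s * Complex.exp (binetTerm s) := by
  have hs0 : s ≠ 0 := by
    rintro rfl; simp at hs
  conv_rhs => enter [1, 2]; rw [← Complex.exp_log hs0]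
  rw [stirlingMain, stirlingMain, log_add_one_of_im_pos hs, binetTerm, ← Complex.exp_add,
    ← Complex.exp_add]
  congr 1
  ring

/-- The iterated functional equation of `stirlingMain`. Its product is the denominator of Euler's
`GammaSeq`, which is how `stirlingMain` is compared with `Γ`. -/
lemma stirlingMain_add_nat {s : ℂ} (hs : 0 < s.im) (N : ℕ) :
    stirlingMain (s + N) = stirlingMain s * (∏ k ∈ Finset.range N, (s + k)) *
      Complex.exp (∑ k ∈ Finset.range N, binetTerm (s + k)) := by
  induction N with
  | zero => simp
  | succ N ih =>
    have : s + ((N + 1 : ℕ) : ℂ) = (s + N) + 1 := by push_cast; ring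
    rw [this, stirlingMain_add_one (by simpa using hs), ih, Finset.prod_range_succ,
      Finset.sum_range_succ, Complex.exp_add]
    ring

lemma inv_sq_add_four_le (x : ℝ) (k : ℕ) :
    2 / ((x + k) ^ 2 + 4) ≤ 2 * (2 + (1 - x) ^ 2) * (1 / ((k + 1 : ℕ) : ℝ) ^ 2) := by
  rw [mul_one_div, div_le_div_iff₀ (by positivity) (by positivity)]
  push_cast
  nlinarith [sq_nonneg (x + k - (1 - x)), sq_nonneg (x + k), sq_nonneg (1 - x),
    mul_nonneg (sq_nonneg (x + k)) (sq_nonneg (1 - x))]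

lemma summable_inv_sq_bound (x : ℝ) :
    Summable fun k : ℕ => 2 * (2 + (1 - x) ^ 2) * (1 / ((k + 1 : ℕ) : ℝ) ^ 2) :=
  (((summable_nat_add_iff 1).2 (Real.summable_one_div_nat_pow.2 one_lt_two))).mul_left _

lemma norm_binetTerm_add_nat_le {s : ℂ} (hs : 2 ≤ s.im) (k : ℕ) :
    ‖binetTerm (s + k)‖ ≤ 2 * (2 + (1 - s.re) ^ 2) * (1 / ((k + 1 : ℕ) : ℝ) ^ 2) := by
  have h2 : 2 ≤ ‖s + k‖ := by
    have := Complex.abs_im_le_norm (s + k)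
    simp only [Complex.add_im, Complex.natCast_im, add_zero] at this
    exact hs.trans ((le_abs_self _).trans this)
  refine (norm_binetTerm_le h2).trans (le_trans ?_ (inv_sq_add_four_le s.re k))
  gcongr
  rw [← Complex.normSq_eq_norm_sq, Complex.normSq_apply]
  simp only [Complex.add_re, Complex.natCast_re, Complex.add_im, Complex.natCast_im, add_zero]
  nlinarith

lemma summable_binetTerm {s : ℂ} (hs : 2 ≤ s.im) : Summable fun k : ℕ => binetTerm (s + k) :=
  Summable.of_norm_bounded (summable_inv_sq_bound s.re) (norm_binetTerm_add_nat_le hs)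

open Filter Topology in
/-- The constant `√(2π)` is the one in Stirling's formula for factorials. -/
lemma tendsto_cpow_mul_factorial_div_stirlingMain {s : ℂ} (hs : 0 < s.im) :
    Tendsto (fun n : ℕ => (n : ℂ) ^ s * (n.factorial : ℂ) / stirlingMain (s + (n + 1 : ℕ))) atTop
      (𝓝 ((√Real.pi : ℝ) * (√2 : ℝ))) := by
  set L : ℕ → ℂ := fun n => Complex.log (1 + (s + 1) / n) with hL
  have hdiv : Tendsto (fun n : ℕ => (s + 1) / (n : ℂ)) atTop (𝓝 0) := by
    simpa [div_eq_mul_inv] using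
      (tendsto_inv_atTop_nhds_zero_nat (𝕜 := ℂ)).const_mul (s + 1)
  have hL0 : Tendsto L atTop (𝓝 0) := by
    have : Tendsto (fun n : ℕ => 1 + (s + 1) / (n : ℂ)) atTop (𝓝 1) := by
      simpa using hdiv.const_add 1
    simpa [hL] using (this.clog (by simp))
  have hnL : Tendsto (fun n : ℕ => (n : ℂ) * L n) atTop (𝓝 (s + 1)) := by
    have h : Tendsto (fun x : ℝ => (x : ℂ) * ((s + 1) / (x : ℂ))) atTop (𝓝 (s + 1)) := by
      refine tendsto_const_nhds.congr' ?_
      filter_upwards [eventually_gt_atTop 0] with x hx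
      have : (x : ℂ) ≠ 0 := by exact_mod_cast hx.ne'
      field_simp
    refine ((Complex.tendsto_mul_log_one_add_of_tendsto h).comp
      tendsto_natCast_atTop_atTop).congr fun n => ?_
    simp [hL]
  have hS : Tendsto (fun n : ℕ => ((Stirling.stirlingSeq n : ℝ) : ℂ)) atTop
      (𝓝 ((√Real.pi : ℝ) : ℂ)) :=
    (Complex.continuous_ofReal.tendsto _).comp Stirling.tendsto_stirlingSeq_sqrt_pi
  have hE : Tendsto (fun n : ℕ => Complex.exp (-(s + 1 / 2) * L n - n * L n + s + 1)) atTop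
      (𝓝 1) := by
    have h := ((hL0.const_mul (-(s + 1 / 2))).sub hnL).add_const (s + 1)
    have h2 := h.cexp
    rw [show -(s + 1 / 2) * 0 - (s + 1) + (s + 1) = 0 by ring, Complex.exp_zero] at h2
    refine h2.congr fun n => ?_
    congr 1; ring
  have hmain := (hS.mul_const ((√2 : ℝ) : ℂ)).mul hE
  rw [mul_one] at hmain
  refine hmain.congr' ?_
  filter_upwards [eventually_gt_atTop 0] with n hn
  have hn' : (0 : ℝ) < n := by exact_mod_cast hn
  have hnc : (n : ℂ) ≠ 0 := by exact_mod_cast hn.ne'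
  have hlog : Complex.log (s + (n + 1 : ℕ)) = (Real.log n : ℝ) + L n := by
    rw [hL, ← Complex.log_mul_ofReal _ hn']
    · congr 1; push_cast; field_simp; ring
    · intro h0
      have := congrArg Complex.im h0
      simp [Complex.div_natCast_im] at this
      rcases this with h | h
      · exact hs.ne' h
      · omega
  have hfac : (n.factorial : ℂ) = ((Stirling.stirlingSeq n : ℝ) : ℂ) * (√2 : ℝ) *
      Complex.exp ((1 / 2) * (Real.log n : ℝ) + n * (Real.log n : ℝ) - n) := by
    have hr : (n.factorial : ℝ) = Stirling.stirlingSeq n * √2 *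
      Real.exp ((1 / 2) * Real.log n + n * Real.log n - n) := by
      have h1 : Real.exp ((1 / 2) * Real.log n + n * Real.log n - n)
          = √n * (n / Real.exp 1) ^ n := by
        rw [Real.exp_sub, Real.exp_add, div_pow, Real.sqrt_eq_rpow, Real.rpow_def_of_pos hn',
          ← Real.exp_nat_mul 1 n, ← Real.exp_log hn', ← Real.exp_nat_mul, Real.exp_log hn']
        rw [mul_comm (Real.log n) (1 / 2), mul_one]
        ring
      rw [h1, Stirling.stirlingSeq, Real.sqrt_mul two_pos.le]
      field_simp
    have := congrArg (fun x : ℝ => (x : ℂ)) hr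
    push_cast at this ⊢
    exact this
  have hpow : (n : ℂ) ^ s = Complex.exp (s * (Real.log n : ℝ)) := by
    rw [Complex.cpow_def_of_ne_zero hnc, ← Complex.natCast_log, mul_comm]
  rw [hpow, hfac, stirlingMain, hlog]
  rw [mul_left_comm, mul_div_assoc, ← Complex.exp_add, ← Complex.exp_sub]
  congr 2
  push_cast
  ring

open Filter Topology in
/-- Stirling's formula with Gudermann's series for the remainder, in the half plane `Im s ≥ 2`. -/
theorem Gamma_eq_stirlingMain_mul {s : ℂ} (hs : 2 ≤ s.im) :
    Complex.Gamma s = ((√Real.pi : ℝ) * (√2 : ℝ)) * stirlingMain s *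
      Complex.exp (∑' k : ℕ, binetTerm (s + k)) := by
  have hs0 : 0 < s.im := by linarith
  have h1 := tendsto_cpow_mul_factorial_div_stirlingMain hs0
  have h2 : Tendsto (fun n : ℕ => Complex.exp (∑ k ∈ Finset.range (n + 1), binetTerm (s + k)))
      atTop (𝓝 (Complex.exp (∑' k : ℕ, binetTerm (s + k)))) :=
    ((summable_binetTerm hs).hasSum.tendsto_sum_nat.comp (tendsto_add_atTop_nat 1)).cexp
  have h3 := (h1.mul_const (stirlingMain s)).mul h2
  refine tendsto_nhds_unique (Complex.GammaSeq_tendsto_Gamma s) (h3.congr fun n => ?_)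
  have hne : (∏ k ∈ Finset.range (n + 1), (s + k)) ≠ 0 := by
    refine Finset.prod_ne_zero_iff.2 fun k _ h0 => ?_
    have := congrArg Complex.im h0
    simp at this
    exact hs0.ne' this
  rw [stirlingMain_add_nat hs0, Complex.GammaSeq]
  have e1 : stirlingMain s ≠ 0 := Complex.exp_ne_zero _
  have e2 := Complex.exp_ne_zero (∑ k ∈ Finset.range (n + 1), binetTerm (s + k))
  field_simp

open Filter Topology in
/-- The function `f` of a real variable is asymptotic to a nonzero multiple of
`exp (κ t log t + p log t + c t)` as `t → ∞`. -/
def HasStirlingForm (f : ℝ → ℂ) (κ p c : ℂ) : Prop :=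
  ∃ C : ℂ, C ≠ 0 ∧ Tendsto (fun t : ℝ =>
    f t * Complex.exp (-(κ * (t * Real.log t) + p * Real.log t + c * t))) atTop (𝓝 C)

namespace HasStirlingForm

open Filter Topology

variable {f g : ℝ → ℂ} {κ p c κ' p' c' : ℂ}

lemma mul (hf : HasStirlingForm f κ p c) (hg : HasStirlingForm g κ' p' c') :
    HasStirlingForm (fun t => f t * g t) (κ + κ') (p + p') (c + c') := by
  obtain ⟨C, hC, h⟩ := hf
  obtain ⟨D, hD, h'⟩ := hg
  refine ⟨C * D, mul_ne_zero hC hD, (h.mul h').congr fun t => ?_⟩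
  rw [mul_mul_mul_comm, ← Complex.exp_add]
  congr 2
  ring

lemma inv (hf : HasStirlingForm f κ p c) :
    HasStirlingForm (fun t => (f t)⁻¹) (-κ) (-p) (-c) := by
  obtain ⟨C, hC, h⟩ := hf
  refine ⟨C⁻¹, inv_ne_zero hC, (h.inv₀ hC).congr fun t => ?_⟩
  rw [mul_inv, ← Complex.exp_neg]
  congr 2
  ring

lemma star (hf : HasStirlingForm f κ p c) :
    HasStirlingForm (fun t => conj (f t)) (conj κ) (conj p) (conj c) := by
  obtain ⟨C, hC, h⟩ := hf
  refine ⟨conj C, by simpa using hC,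
    ((Complex.continuous_conj.tendsto _).comp h).congr fun t => ?_⟩
  simp [← Complex.exp_conj]

lemma exp (a b : ℂ) : HasStirlingForm (fun t => Complex.exp (a + b * t)) 0 0 b := by
  refine ⟨Complex.exp a, Complex.exp_ne_zero _, tendsto_const_nhds.congr fun t => ?_⟩
  rw [← Complex.exp_add]
  congr 1
  ring

lemma prod {ι : Type*} (s : Finset ι) {f : ι → ℝ → ℂ} {κ p c : ι → ℂ}
    (h : ∀ i ∈ s, HasStirlingForm (f i) (κ i) (p i) (c i)) :
    HasStirlingForm (fun t => ∏ i ∈ s, f i t) (∑ i ∈ s, κ i) (∑ i ∈ s, p i) (∑ i ∈ s, c i) := by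
  classical
  induction s using Finset.induction_on with
  | empty => exact ⟨1, one_ne_zero, by simp⟩
  | insert a s ha ih =>
    simp only [Finset.prod_insert ha, Finset.sum_insert ha]
    exact (h a (Finset.mem_insert_self a s)).mul (ih fun i hi => h i (Finset.mem_insert_of_mem hi))

lemma eventually_ne_zero (hf : HasStirlingForm f κ p c) : ∀ᶠ t in atTop, f t ≠ 0 := by
  obtain ⟨C, hC, h⟩ := hf
  filter_upwards [h.eventually_ne hC] with t ht h0
  simp [h0] at ht

lemma congr' (hf : HasStirlingForm f κ p c) (h : f =ᶠ[atTop] g) : HasStirlingForm g κ p c := by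
  obtain ⟨C, hC, h'⟩ := hf
  refine ⟨C, hC, h'.congr' ?_⟩
  filter_upwards [h] with t ht
  rw [ht]

end HasStirlingForm

open Filter Topology in
/-- Stirling's formula on a vertical line. The constant term `β` stands for `l σ + μ` when the gamma
factor `Γ(l s + μ)` is taken at `s = σ + it`. -/
theorem hasStirlingForm_Gamma {l : ℝ} (hl : 0 < l) (β : ℂ) :
    HasStirlingForm (fun t => Complex.Gamma (l * (I * t) + β)) (I * l) (β - 1 / 2)
      (I * l * Real.log l - Real.pi * l / 2 - I * l) := by
  set s : ℝ → ℂ := fun t => l * (I * t) + β with hs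
  have him : ∀ t, (s t).im = l * t + β.im := fun t => by simp [hs]
  have hre : ∀ t, (s t).re = β.re := fun t => by simp [hs]
  have himtop : Tendsto (fun t => (s t).im) atTop atTop := by
    simp only [him]
    exact tendsto_atTop_add_const_right _ _ (tendsto_id.const_mul_atTop hl)
  -- the remainder tends to `0`, by dominated convergence for series
  have hJ : Tendsto (fun t => ∑' k : ℕ, binetTerm (s t + k)) atTop (𝓝 0) := by
    have hb := summable_inv_sq_bound β.re
    have := tendsto_tsum_of_dominated_convergence (𝓕 := atTop)
      (f := fun t k => binetTerm (s t + (k : ℕ))) (g := fun _ => 0) hb ?_ ?_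
    · simpa using this
    · intro k
      have hk : Tendsto (fun t => ‖s t + k‖) atTop atTop :=
        tendsto_atTop_mono (fun t => by
          simpa using (le_abs_self _).trans (Complex.abs_im_le_norm (s t + k))) himtop
      refine squeeze_zero_norm' (a := fun t => 2 / ‖s t + k‖ ^ 2) ?_ ?_
      · filter_upwards [hk.eventually_ge_atTop 2] with t ht using norm_binetTerm_le ht
      · exact tendsto_const_nhds.div_atTop ((tendsto_pow_atTop two_ne_zero).comp hk)
    · filter_upwards [himtop.eventually_ge_atTop 2] with t ht k
      simpa [hre] using norm_binetTerm_add_nat_le ht k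
  set L : ℝ → ℂ := fun t => Complex.log (1 + β / (l * I) / t) with hL
  have hinv : Tendsto (fun t : ℝ => β / (l * I) / (t : ℂ)) atTop (𝓝 0) := by
    have := (Complex.continuous_ofReal.tendsto _).comp tendsto_inv_atTop_zero
    simpa [div_eq_mul_inv, Function.comp_def] using this.const_mul (β / (l * I))
  have hone : Tendsto (fun t : ℝ => 1 + β / (l * I) / (t : ℂ)) atTop (𝓝 1) := by
    simpa using hinv.const_add 1
  have hL0 : Tendsto L atTop (𝓝 0) := by simpa [hL] using (hone.clog (by simp))
  have htL : Tendsto (fun t : ℝ => (t : ℂ) * L t) atTop (𝓝 (β / (l * I))) := by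
    refine Complex.tendsto_mul_log_one_add_of_tendsto (tendsto_const_nhds.congr' ?_)
    filter_upwards [eventually_gt_atTop 0] with x hx
    have : (x : ℂ) ≠ 0 := by exact_mod_cast hx.ne'
    field_simp
  have hlI : (l : ℂ) * I ≠ 0 := mul_ne_zero (by exact_mod_cast hl.ne') I_ne_zero
  have hlog : ∀ᶠ t in atTop, Complex.log (s t) =
      Real.log l + Real.log t + Real.pi / 2 * I + L t := by
    have harg : Tendsto (fun t : ℝ => (1 + β / (l * I) / (t : ℂ)).arg) atTop (𝓝 0) := by
      have := (Complex.continuousAt_arg (x := 1) (by simp)).tendsto.comp hone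
      simpa [Function.comp_def] using this
    filter_upwards [eventually_gt_atTop 0, hone.eventually_ne one_ne_zero,
      harg.eventually (Ioo_mem_nhds (neg_lt_zero.2 Real.pi_div_two_pos) Real.pi_div_two_pos)]
      with t ht hne ha
    have hlt : 0 < l * t := mul_pos hl ht
    have htc : (t : ℂ) ≠ 0 := by exact_mod_cast ht.ne'
    have hlc : (l : ℂ) ≠ 0 := by exact_mod_cast hl.ne'
    have e : s t = I * (1 + β / (l * I) / t) * ((l * t : ℝ) : ℂ) := by
      simp only [hs]
      push_cast
      field_simp
    rw [e, Complex.log_mul_ofReal _ hlt _ (mul_ne_zero I_ne_zero hne),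
      Complex.log_mul I_ne_zero hne, Real.log_mul hl.ne' ht.ne', Complex.log_I]
    · push_cast; ring
    · rw [Complex.arg_I]
      constructor <;> linarith [ha.1, ha.2, Real.pi_pos]
  have hE : Tendsto (fun t : ℝ => Complex.exp ((β - 1 / 2) * (Real.log l + Real.pi / 2 * I) +
      l * I * (t * L t) + (β - 1 / 2) * L t - β)) atTop
      (𝓝 (Complex.exp ((β - 1 / 2) * (Real.log l + Real.pi / 2 * I)))) := by
    have h := (((htL.const_mul (l * I)).add (hL0.const_mul (β - 1 / 2))).const_add
      ((β - 1 / 2) * (Real.log l + Real.pi / 2 * I))).sub_const β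
    rw [mul_zero, mul_div_cancel₀ _ hlI, add_zero, add_sub_cancel_right] at h
    refine h.cexp.congr fun t => ?_
    congr 1; ring
  refine ⟨((√Real.pi : ℝ) * (√2 : ℝ)) *
    Complex.exp ((β - 1 / 2) * (Real.log l + Real.pi / 2 * I)) * Complex.exp 0, ?_, ?_⟩
  · have h1 : (√Real.pi : ℝ) ≠ 0 := (Real.sqrt_pos.2 Real.pi_pos).ne'
    have h2 : (√2 : ℝ) ≠ 0 := (Real.sqrt_pos.2 two_pos).ne'
    refine mul_ne_zero (mul_ne_zero (mul_ne_zero ?_ ?_) (Complex.exp_ne_zero _))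
      (Complex.exp_ne_zero _)
    · exact_mod_cast h1
    · exact_mod_cast h2
  · refine ((hE.const_mul ((√Real.pi : ℝ) * (√2 : ℝ) : ℂ)).mul hJ.cexp).congr' ?_
    filter_upwards [himtop.eventually_ge_atTop 2, hlog] with t ht hlt
    have key : Complex.exp ((β - 1 / 2) * (Real.log l + Real.pi / 2 * I) +
        l * I * (t * L t) + (β - 1 / 2) * L t - β) =
        Complex.exp ((s t - 1 / 2) * (Real.log l + Real.log t + Real.pi / 2 * I + L t) - s t) *
        Complex.exp (-(I * l * (t * Real.log t) + (β - 1 / 2) * Real.log t +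
          (I * l * Real.log l - Real.pi * l / 2 - I * l) * t)) := by
      rw [← Complex.exp_add]
      congr 1
      simp only [hs]
      linear_combination (-(1 / 2) * l * t * Real.pi : ℂ) * Complex.I_sq
    rw [Gamma_eq_stirlingMain_mul ht, stirlingMain, hlt, key]
    ring

/-! ### Gamma factors and growth in vertical strips -/

/-- The gamma factor with the conjugate parameters `conj μⱼ`. -/
noncomputable def GammaFactor.conjFactor (g : GammaFactor) : GammaFactor where
  r := g.r
  Q := g.Q
  lam := g.lam
  mu := fun j => conj (g.mu j)
  Q_pos := g.Q_pos
  lam_pos := g.lam_pos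
  mu_re_nonneg := fun j => by simpa using g.mu_re_nonneg j

lemma GammaFactor.eval_conjFactor (g : GammaFactor) (s : ℂ) :
    g.conjFactor.eval s = conj (g.eval (conj s)) := by
  have hQ : (g.Q : ℂ).arg ≠ Real.pi := by
    rw [Complex.arg_ofReal_of_nonneg g.Q_pos.le]; exact Real.pi_ne_zero.symm
  simp only [GammaFactor.eval, GammaFactor.conjFactor, map_mul, map_prod, ← Complex.Gamma_conj,
    map_add, Complex.conj_ofReal, Complex.conj_conj]
  rw [Complex.cpow_conj _ _ hQ]
  simp only [Complex.conj_conj, Complex.conj_ofReal]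
  rfl

lemma GammaFactor.regularAt_conjFactor (g : GammaFactor) (s : ℂ) :
    g.conjFactor.RegularAt s ↔ g.RegularAt (conj s) := by
  refine forall_congr' fun j => forall_congr' fun n => not_congr ?_
  constructor
  · intro h
    have := congrArg conj h
    simpa [GammaFactor.conjFactor] using this
  · intro h
    have := congrArg conj h
    simpa [GammaFactor.conjFactor] using this

open Filter Topology in
lemma GammaFactor.hasStirlingForm_eval (g : GammaFactor) (σ : ℝ) :
    HasStirlingForm (fun t => g.eval (σ + I * t)) (I * (g.degree / 2 : ℝ))
      (∑ j, (g.lam j * σ + g.mu j - 1 / 2))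
      (I * (Real.log g.Q + ∑ j, (g.lam j * Real.log (g.lam j) - g.lam j) : ℝ) -
        (Real.pi * g.degree / 4 : ℝ)) := by
  have h1 : HasStirlingForm (fun t => (g.Q : ℂ) ^ ((σ : ℂ) + I * t)) 0 0 (I * Real.log g.Q) := by
    refine (HasStirlingForm.exp (Real.log g.Q * σ) (I * Real.log g.Q)).congr'
      (Eventually.of_forall fun t => ?_)
    simp only
    rw [Complex.cpow_def_of_ne_zero (by exact_mod_cast g.Q_pos.ne'),
      ← Complex.ofReal_log g.Q_pos.le]
    congr 1
    ring
  have h2 := HasStirlingForm.prod Finset.univ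
    fun j _ => hasStirlingForm_Gamma (g.lam_pos j) (g.lam j * σ + g.mu j)
  have h3 := h1.mul h2
  have e1 : (0 : ℂ) + ∑ j, I * (g.lam j : ℂ) = I * (g.degree / 2 : ℝ) := by
    rw [zero_add, ← Finset.mul_sum, GammaFactor.degree, mul_div_cancel_left₀ _ two_ne_zero]
    push_cast; rfl
  have e2 : I * (Real.log g.Q : ℂ) + ∑ j, (I * (g.lam j : ℂ) * Real.log (g.lam j) -
      Real.pi * g.lam j / 2 - I * g.lam j) =
      I * (Real.log g.Q + ∑ j, (g.lam j * Real.log (g.lam j) - g.lam j) : ℝ) -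
        (Real.pi * g.degree / 4 : ℝ) := by
    rw [GammaFactor.degree]
    push_cast
    simp only [Finset.sum_sub_distrib, mul_assoc, ← Finset.mul_sum, ← Finset.sum_div]
    ring
  rw [e1, e2, zero_add] at h3
  refine h3.congr' (Eventually.of_forall fun t => ?_)
  simp only [GammaFactor.eval]
  congr 1
  refine Finset.prod_congr rfl fun j _ => ?_
  congr 1
  ring

open Filter Topology in
lemma GammaFactor.eventually_regularAt (g : GammaFactor) (σ : ℝ) :
    ∀ᶠ t : ℝ in atTop, g.RegularAt (σ + I * t) := by
  rw [show (∀ᶠ t : ℝ in atTop, g.RegularAt (σ + I * t)) ↔ ∀ᶠ t : ℝ in atTop, ∀ j, ∀ n : ℕ,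
    (g.lam j : ℂ) * (σ + I * t) + g.mu j ≠ -(n : ℂ) from Iff.rfl, eventually_all]
  intro j
  have : Tendsto (fun t : ℝ => g.lam j * t + (g.mu j).im) atTop atTop :=
    tendsto_atTop_add_const_right _ _ (tendsto_id.const_mul_atTop (g.lam_pos j))
  filter_upwards [this.eventually_gt_atTop 0] with t ht n h
  have := congrArg Complex.im h
  simp at this
  exact ht.ne' this

open Filter Topology in
/-- The functional equation at `-1 + it`, which is reflected to `2 + it`. For large `t` neither point
is a pole of a gamma function, so that the equation is available. -/
lemma SatisfiesFunctionalEquation.eventually {g : GammaFactor} {ω : ℂ} {F : ℂ → ℂ}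
    (h : SatisfiesFunctionalEquation g ω F) : ∀ᶠ t : ℝ in atTop,
      g.eval (-1 + I * t) * F (-1 + I * t) = ω * conj (g.eval (2 + I * t) * F (2 + I * t)) := by
  filter_upwards [g.eventually_regularAt (-1), g.eventually_regularAt 2] with t h1 h2
  have e : conj (1 - (-1 + I * (t : ℂ))) = 2 + I * t := by
    simp; ring
  have := h (-1 + I * t) (fun h0 => by simpa using congrArg re h0)
    (fun h0 => by have := congrArg re h0; norm_num at this) (by simpa using h1)
    (by rw [e]; simpa using h2)
  rwa [conjFun, e] at this

/-- The conjugate function satisfies the functional equation with conjugate data. -/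
lemma SatisfiesFunctionalEquation.conjFun {g : GammaFactor} {ω : ℂ} {F : ℂ → ℂ}
    (h : SatisfiesFunctionalEquation g ω F) :
    SatisfiesFunctionalEquation g.conjFactor (conj ω) (conjFun F) := by
  intro s h0 h1 hs hs'
  rw [GammaFactor.regularAt_conjFactor] at hs hs'
  have := h (conj s) (by simpa using h0) (fun h => h1 (by simpa using congrArg conj h)) hs
    (by simpa using hs')
  have h2 := congrArg conj this
  simp only [_root_.conjFun, map_mul, map_sub, map_one, Complex.conj_conj,
    GammaFactor.eval_conjFactor] at h2 ⊢
  exact h2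

open Filter Topology Asymptotics in
/-- The size of the quotient of the values of a gamma factor of degree `1` on the lines `Re s = 2`
and `Re s = -1`. -/
lemma GammaFactor.eventually_norm_eval_le (g : GammaFactor) (hg : g.degree = 1) :
    ∃ K : ℝ, 0 ≤ K ∧ ∀ᶠ t : ℝ in atTop,
      g.eval (-1 + I * t) ≠ 0 ∧ ‖g.eval (2 + I * t)‖ ≤ K * t ^ 2 * ‖g.eval (-1 + I * t)‖ := by
  have h1 := g.hasStirlingForm_eval 2
  have h2 := g.hasStirlingForm_eval (-1)
  have h3 := h1.mul h2.inv
  obtain ⟨C, hC, hlim⟩ := h3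
  refine ⟨‖C‖ + 1, by positivity, ?_⟩
  have h4 := hlim.norm.eventually_le_const (lt_add_one ‖C‖)
  filter_upwards [h4, h2.eventually_ne_zero, eventually_ge_atTop 1] with t ht hne h1t
  simp only [Complex.ofReal_neg, Complex.ofReal_one, Complex.ofReal_ofNat] at ht hne
  refine ⟨hne, ?_⟩
  have ht0 : 0 < t := by linarith
  have hp : ∑ j, ((g.lam j : ℂ) * 2 + g.mu j - 1 / 2) +
      -∑ j, ((g.lam j : ℂ) * (-1) + g.mu j - 1 / 2) = (3 / 2 : ℝ) := by
    rw [← sub_eq_add_neg, ← Finset.sum_sub_distrib]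
    have : ∀ j, ((g.lam j : ℂ) * 2 + g.mu j - 1 / 2) - ((g.lam j : ℂ) * (-1) + g.mu j - 1 / 2)
        = 3 * g.lam j := fun j => by ring
    simp only [this, ← Finset.mul_sum]
    have hd : (∑ j, g.lam j) = 1 / 2 := by
      have := hg; rw [GammaFactor.degree] at this; linarith
    rw [← Complex.ofReal_sum, hd]
    push_cast; ring
  rw [hp, ← sub_eq_add_neg, ← sub_eq_add_neg, sub_self, sub_self, zero_mul, zero_mul, zero_add,
    add_zero, norm_mul, norm_mul, norm_inv, Complex.norm_exp] at ht
  have hre : (-(((3 / 2 : ℝ) : ℂ) * (Real.log t : ℂ))).re = -(3 / 2 * Real.log t) := by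
    rw [← Complex.ofReal_mul, ← Complex.ofReal_neg, Complex.ofReal_re]
  rw [hre, Real.exp_neg, ← div_eq_mul_inv, ← div_eq_mul_inv, div_div,
    div_le_iff₀ (mul_pos (norm_pos_iff.2 hne) (Real.exp_pos _))] at ht
  have h5 : Real.exp (3 / 2 * Real.log t) ≤ t ^ 2 := by
    rw [mul_comm, ← Real.rpow_def_of_pos ht0, ← Real.rpow_natCast]
    exact Real.rpow_le_rpow_of_exponent_le h1t (by norm_num)
  calc _ ≤ _ := ht
    _ ≤ (‖C‖ + 1) * (‖g.eval (-1 + I * t)‖ * t ^ 2) := by gcongr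
    _ = _ := by ring

open Filter Topology in
/-- The asymptotic shape of the kernel `Γ(w) γ*(1 - w) / γ(w)` on the line `Re w = -1` for a gamma
factor of degree `1`: the powers `t ^ t` cancel. -/
lemma GammaFactor.hasStirlingForm_kernel (g : GammaFactor) (hg : g.degree = 1) :
    ∃ θ ρ : ℝ, HasStirlingForm
      (fun t => Complex.Gamma (-1 + I * t) * (conj (g.eval (2 + I * t)) / g.eval (-1 + I * t)))
      0 (I * θ) (-(Real.pi / 2) - I * ρ) := by
  have h1 := (g.hasStirlingForm_eval 2).star
  have h2 := (g.hasStirlingForm_eval (-1)).inv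
  have h0 := hasStirlingForm_Gamma one_pos (-1)
  have h3 := h0.mul (h1.mul h2)
  have hd : (∑ j, g.lam j) = 1 / 2 := by
    have := hg; rw [GammaFactor.degree] at this; linarith
  refine ⟨-2 * ∑ j, (g.mu j).im, 2 * (Real.log g.Q + ∑ j, g.lam j * Real.log (g.lam j)), ?_⟩
  convert! h3 using 1
  · ext t
    simp only [Complex.ofReal_neg, Complex.ofReal_one, Complex.ofReal_ofNat, one_mul]
    rw [add_comm (-1 : ℂ), div_eq_mul_inv]
  · rw [hg]
    simp only [map_mul, Complex.conj_I, Complex.conj_ofReal]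
    push_cast
    ring
  · simp only [map_sum, map_sub, map_add, map_mul, Complex.conj_ofReal, map_div₀, map_one,
      Complex.conj_ofNat]
    have : ∀ j, (g.lam j : ℂ) * ((2 : ℝ) : ℂ) + conj (g.mu j) - 1 / 2 =
        ((g.lam j : ℂ) * ((-1 : ℝ) : ℂ) + g.mu j - 1 / 2) + (3 * g.lam j + -2 * I * (g.mu j).im) := by
      intro j
      have h1 := Complex.re_add_im (g.mu j)
      have h2 : conj (g.mu j) = (g.mu j).re - (g.mu j).im * I := by
        apply Complex.ext <;> simp
      rw [h2]
      push_cast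
      linear_combination h1
    simp only [this, Finset.sum_add_distrib, ← Finset.mul_sum]
    rw [← Complex.ofReal_sum, hd]
    push_cast
    ring
  · rw [hg]
    simp only [map_sub, map_mul, Complex.conj_I, Complex.conj_ofReal, Finset.sum_sub_distrib, hd]
    push_cast
    rw [Real.log_one]
    push_cast
    ring

lemma norm_sub_one_le_norm_add_three {s : ℂ} (hs : -1 ≤ s.re) : ‖s - 1‖ ≤ ‖s + 3‖ := by
  rw [← pow_le_pow_iff_left₀ (norm_nonneg _) (norm_nonneg _) two_ne_zero, ← Complex.normSq_eq_norm_sq,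
    ← Complex.normSq_eq_norm_sq, Complex.normSq_apply, Complex.normSq_apply]
  simp only [sub_re, one_re, sub_im, one_im, add_re, re_ofNat, add_im, im_ofNat]
  nlinarith

lemma LSeries_norm_le {a : ℕ → ℂ} (ha : LSeriesSummable a 2) {s : ℂ} (hs : s.re = 2) :
    ‖LSeries a s‖ ≤ ∑' n, ‖LSeries.term a 2 n‖ := by
  refine (norm_tsum_le_tsum_norm ?_).trans (le_of_eq (tsum_congr fun n => ?_))
  · exact (ha.of_re_le_re (by simp [hs])).norm
  · simp [LSeries.norm_term_eq, hs]

open Filter Topology in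
/-- On the line `Re s = -1` the size of `F` is controlled by the functional equation. -/
lemma SatisfiesFunctionalEquation.eventually_norm_le {g : GammaFactor} {ω : ℂ} {F : ℂ → ℂ}
    (h : SatisfiesFunctionalEquation g ω F) (hω : ‖ω‖ = 1) (hg : g.degree = 1) {M : ℝ}
    (hM : ∀ s : ℂ, s.re = 2 → ‖F s‖ ≤ M) :
    ∃ K : ℝ, 0 ≤ K ∧ ∀ᶠ t : ℝ in atTop, ‖F (-1 + I * t)‖ ≤ K * t ^ 2 := by
  obtain ⟨K, hK, hev⟩ := g.eventually_norm_eval_le hg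
  have hM0 : 0 ≤ M := (norm_nonneg _).trans (hM 2 (by simp))
  refine ⟨K * M, by positivity, ?_⟩
  filter_upwards [hev, h.eventually] with t ⟨hne, ht⟩ hfe
  have h1 := congrArg norm hfe
  rw [norm_mul, norm_mul, hω, one_mul, Complex.norm_conj, norm_mul] at h1
  have hpos := norm_pos_iff.2 hne
  refine le_of_mul_le_mul_left ?_ hpos
  calc _ = _ := h1
    _ ≤ (K * t ^ 2 * ‖g.eval (-1 + I * t)‖) * M :=
        mul_le_mul ht (hM _ (by simp)) (norm_nonneg _) (by positivity)
    _ = _ := by ring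

open Filter Topology in
lemma eventually_rpow_le_exp (ρ : ℝ) : ∀ᶠ y : ℝ in atTop, (y + 2) ^ ρ ≤ Real.exp y := by
  have h := (isLittleO_rpow_exp_pos_mul_atTop ρ (one_pos (α := ℝ))).bound
    (c := Real.exp (-2)) (Real.exp_pos _)
  have h2 := (tendsto_atTop_add_const_right atTop (2 : ℝ) tendsto_id).eventually h
  filter_upwards [h2, eventually_ge_atTop 0] with y hy hy0
  simp only [id, one_mul] at hy
  rw [Real.norm_of_nonneg (by positivity), Real.norm_of_nonneg (by positivity),
    ← Real.exp_add] at hy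
  simpa using hy

open Filter Topology in
/-- An entire function of finite order is bounded by `‖s + 3‖ ^ k` in the strip `-1 ≤ Re s ≤ 2` as
soon as it is so on its edges: the Phragmén–Lindelöf principle. -/
lemma IsEntireOfFiniteOrder.norm_le_of_edges {E : ℂ → ℂ} (hE : IsEntireOfFiniteOrder E) {k : ℕ}
    {A : ℝ} (h1 : ∀ s : ℂ, s.re = -1 → ‖E s‖ ≤ A * ‖s + 3‖ ^ k)
    (h2 : ∀ s : ℂ, s.re = 2 → ‖E s‖ ≤ A * ‖s + 3‖ ^ k) {s : ℂ} (hs1 : -1 ≤ s.re)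
    (hs2 : s.re ≤ 2) : ‖E s‖ ≤ A * ‖s + 3‖ ^ k := by
  obtain ⟨hd, ρ, C, hρ, hC⟩ := hE
  have hC0 : 0 ≤ C := by
    have := (norm_nonneg _).trans (hC 0)
    exact nonneg_of_mul_nonneg_left this (Real.exp_pos _)
  have hnz : ∀ s : ℂ, -1 ≤ s.re → 1 ≤ ‖s + 3‖ := fun s hs => by
    have := (le_abs_self _).trans (Complex.abs_re_le_norm (s + 3))
    simp at this
    linarith
  have hpos : ∀ s : ℂ, -1 ≤ s.re → 0 < ‖s + 3‖ ^ k := fun s hs =>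
    pow_pos (zero_lt_one.trans_le (hnz s hs)) k
  have key : ‖E s / (s + 3) ^ k‖ ≤ A := by
    refine PhragmenLindelof.vertical_strip (a := -1) (b := 2) (C := A)
      (f := fun s => E s / (s + 3) ^ k) ?_ ?_ ?_ ?_ hs1 hs2
    · have hcl : closure (re ⁻¹' Set.Ioo (-1 : ℝ) 2) ⊆ {s : ℂ | -1 ≤ s.re} := by
        refine closure_minimal (fun s hs => hs.1.le) (isClosed_le continuous_const continuous_re)
      refine DifferentiableOn.diffContOnCl fun s hs => ?_
      refine (hd s).differentiableWithinAt.div (by fun_prop) ?_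
      have := hpos s (hcl hs)
      rw [← norm_pow] at this
      exact norm_pos_iff.1 this
    · refine ⟨1, by rw [lt_div_iff₀ (by norm_num)]; linarith [Real.pi_gt_three], 1, ?_⟩
      refine Asymptotics.IsBigO.of_bound C ?_
      have hev : ∀ᶠ z in comap (_root_.abs ∘ im) atTop ⊓ 𝓟 (re ⁻¹' Set.Ioo (-1 : ℝ) 2),
          (|z.im| + 2) ^ ρ ≤ Real.exp |z.im| :=
        (tendsto_comap.eventually (eventually_rpow_le_exp ρ)).filter_mono inf_le_left
      have hmem : ∀ᶠ z in comap (_root_.abs ∘ im) atTop ⊓ 𝓟 (re ⁻¹' Set.Ioo (-1 : ℝ) 2),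
          z ∈ re ⁻¹' Set.Ioo (-1 : ℝ) 2 :=
        (eventually_principal.2 fun _ h => h).filter_mono inf_le_right
      filter_upwards [hev, hmem] with z hz hzm
      have hz3 : 1 ≤ ‖z + 3‖ ^ k := one_le_pow₀ (hnz z hzm.1.le)
      rw [norm_div, norm_pow, Real.norm_of_nonneg (Real.exp_pos _).le]
      refine (div_le_self (norm_nonneg _) hz3).trans ((hC z).trans ?_)
      gcongr
      rw [one_mul, one_mul]
      refine le_trans ?_ hz
      refine Real.rpow_le_rpow (norm_nonneg _) ?_ hρ.le
      refine (Complex.norm_le_abs_re_add_abs_im z).trans ?_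
      have : |z.re| ≤ 2 := abs_le.2 ⟨by linarith [hzm.1], hzm.2.le⟩
      linarith
    · intro z hz
      rw [norm_div, norm_pow, div_le_iff₀ (hpos z (by rw [hz]))]
      exact h1 z hz
    · intro z hz
      rw [norm_div, norm_pow, div_le_iff₀ (hpos z (by rw [hz]; norm_num))]
      exact h2 z hz
  rwa [norm_div, norm_pow, div_le_iff₀ (hpos s hs1)] at key

open Filter Topology in
/-- Polynomial growth of an element of degree `1` of the extended Selberg class. -/
lemma IsExtendedSelberg.exists_norm_le {a : ℕ → ℂ} {F : ℂ → ℂ} (hF : IsExtendedSelberg 1 a F) :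
    ∃ (A : ℝ) (k : ℕ), 0 ≤ A ∧ ∀ s : ℂ, -1 ≤ s.re → s.re ≤ 2 → 1 ≤ |s.im| →
      ‖F s‖ ≤ A * ‖s + 3‖ ^ k := by
  obtain ⟨m, E, hE, hEF⟩ := hF.continuation
  obtain ⟨g, ω, hω, hg, hfe⟩ := hF.functional_equation
  set M := ∑' n, ‖LSeries.term a 2 n‖ with hMdef
  have hM : ∀ s : ℂ, s.re = 2 → ‖F s‖ ≤ M := fun s hs => by
    rw [hF.eq_LSeries s (by rw [hs]; norm_num)]
    exact LSeries_norm_le (hF.summable 2 (by simp)) hs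
  have hM0 : 0 ≤ M := tsum_nonneg fun _ => norm_nonneg _
  have hM' : ∀ s : ℂ, s.re = 2 → ‖conjFun F s‖ ≤ M := fun s hs => by
    rw [conjFun, Complex.norm_conj]; exact hM _ (by simpa using hs)
  obtain ⟨K₁, hK₁, h₁⟩ := hfe.eventually_norm_le hω hg hM
  obtain ⟨K₂, hK₂, h₂⟩ := hfe.conjFun.eventually_norm_le (by simpa using hω) hg hM'
  obtain ⟨T, hT⟩ := eventually_atTop.1 (h₁.and h₂)
  -- the compact part of the edge `Re s = -1`
  obtain ⟨B, hB⟩ := (isCompact_Icc (a := -|T|) (b := |T|)).exists_bound_of_continuousOn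
    (f := fun t : ℝ => E (-1 + I * t)) (hE.1.continuous.comp (by fun_prop)).continuousOn
  have hB0 : 0 ≤ B := (norm_nonneg _).trans (hB 0 (by simp))
  have hbig : ∀ s : ℂ, 1 ≤ ‖s + 3‖ → ∀ j : ℕ, (1 : ℝ) ≤ ‖s + 3‖ ^ j := fun s hs j =>
    one_le_pow₀ hs
  have hedge1 : ∀ s : ℂ, s.re = -1 → ‖E s‖ ≤ (M + B + K₁ + K₂) * ‖s + 3‖ ^ (m + 2) := by
    intro s hs
    have h3 : 1 ≤ ‖s + 3‖ := by
      have := (le_abs_self _).trans (Complex.abs_re_le_norm (s + 3))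
      simp [hs] at this
      linarith
    have hs' : s = -1 + I * (s.im : ℂ) := by
      apply Complex.ext <;> simp [hs]
    have him : |s.im| ≤ ‖s + 3‖ := by
      simpa using Complex.abs_im_le_norm (s + 3)
    have hsub : ‖s - 1‖ ≤ ‖s + 3‖ := norm_sub_one_le_norm_add_three (by rw [hs])
    have hgen : ∀ K, 0 ≤ K → ‖F s‖ ≤ K * |s.im| ^ 2 → ‖E s‖ ≤ K * ‖s + 3‖ ^ (m + 2) := by
      intro K hK h
      rw [hEF s (by rintro rfl; norm_num at hs), norm_mul, norm_pow]
      calc _ ≤ ‖s + 3‖ ^ m * (K * ‖s + 3‖ ^ 2) := by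
            gcongr
            exact h.trans (by gcongr)
        _ = _ := by ring
    have hpow : 0 ≤ ‖s + 3‖ ^ (m + 2) := by positivity
    rcases le_total |s.im| |T| with hle | hge
    · have h4 := hB s.im (abs_le.1 hle)
      rw [← hs'] at h4
      have h5 := hbig s h3 (m + 2)
      nlinarith
    · rcases le_total 0 s.im with h0 | h0
      · rw [abs_of_nonneg h0] at hge
        have h4 := (hT s.im ((le_abs_self T).trans hge)).1
        rw [← hs', ← sq_abs] at h4
        have := hgen K₁ hK₁ h4
        nlinarith
      · rw [abs_of_nonpos h0] at hge
        have h4 := (hT (-s.im) ((le_abs_self T).trans hge)).2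
        have h5 : conj (-1 + I * ((-s.im : ℝ) : ℂ)) = s := by
          apply Complex.ext <;> simp [hs]
        rw [conjFun, h5, Complex.norm_conj, neg_sq, ← sq_abs] at h4
        have := hgen K₂ hK₂ h4
        nlinarith
  have hedge2 : ∀ s : ℂ, s.re = 2 → ‖E s‖ ≤ (M + B + K₁ + K₂) * ‖s + 3‖ ^ (m + 2) := by
    intro s hs
    have h3 : 1 ≤ ‖s + 3‖ := by
      have := (le_abs_self _).trans (Complex.abs_re_le_norm (s + 3))
      simp [hs] at this
      linarith
    have hsub : ‖s - 1‖ ≤ ‖s + 3‖ := norm_sub_one_le_norm_add_three (by rw [hs]; norm_num)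
    rw [hEF s (by rintro rfl; norm_num at hs), norm_mul, norm_pow]
    calc _ ≤ ‖s + 3‖ ^ m * M := by gcongr; exact hM s hs
      _ ≤ ‖s + 3‖ ^ (m + 2) * (M + B + K₁ + K₂) := by
          have := pow_le_pow_right₀ h3 (show m ≤ m + 2 by omega)
          exact mul_le_mul this (by linarith) hM0 (by positivity)
      _ = _ := by ring
  refine ⟨M + B + K₁ + K₂, m + 2, by positivity, fun s h1 h2 him => ?_⟩
  have hb := hE.norm_le_of_edges hedge1 hedge2 h1 h2
  have h1s : 1 ≤ ‖s - 1‖ := him.trans (by simpa using Complex.abs_im_le_norm (s - 1))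
  have hne : s ≠ 1 := by rintro rfl; simp at h1s; norm_num at h1s
  rw [hEF s hne, norm_mul, norm_pow] at hb
  refine le_trans ?_ hb
  exact le_mul_of_one_le_left (norm_nonneg _) (one_le_pow₀ h1s)

/-! ### The Cahen–Mellin integral with a complex parameter -/

open MeasureTheory Set in
lemma integrable_exp_neg_mul_abs {ε : ℝ} (hε : 0 < ε) :
    Integrable fun t : ℝ => Real.exp (-ε * |t|) := by
  rw [← integrableOn_univ, ← Iic_union_Ioi (a := (0 : ℝ))]
  refine IntegrableOn.union ?_ ?_
  · refine (integrableOn_exp_mul_Iic hε 0).congr_fun (fun t ht => ?_) measurableSet_Iic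
    simp only [abs_of_nonpos (mem_Iic.1 ht)]
    congr 1; ring
  · refine (exp_neg_integrableOn_Ioi 0 hε).congr_fun (fun t ht => ?_) measurableSet_Ioi
    simp only [abs_of_pos (mem_Ioi.1 ht)]

open MeasureTheory Set in
lemma integrableOn_cpow_mul_exp_neg {w z : ℂ} (hw : 0 < w.re) (hz : 0 < z.re) :
    IntegrableOn (fun t : ℝ => (t : ℂ) ^ (w - 1) * Complex.exp (-(z * t))) (Ioi 0) := by
  have hR := integrableOn_rpow_mul_exp_neg_mul_rpow (s := w.re - 1) (p := 1) (by linarith)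
    one_pos hz
  refine Integrable.mono' hR ?_ ?_
  · refine ContinuousOn.aestronglyMeasurable (fun t ht => ContinuousAt.continuousWithinAt ?_)
      measurableSet_Ioi
    refine ContinuousAt.mul ?_ (by fun_prop)
    exact continuousAt_ofReal_cpow_const _ _ (Or.inr (mem_Ioi.1 ht).ne')
  · refine (ae_restrict_iff' measurableSet_Ioi).2 (Filter.Eventually.of_forall fun t ht => ?_)
    rw [norm_mul, Complex.norm_cpow_eq_rpow_re_of_pos ht, Complex.norm_exp]
    simp

open MeasureTheory Set Filter Topology in
/-- Euler's integral with a complex scaling parameter in the right half plane, by the identity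
theorem. -/
lemma integral_cpow_mul_exp_neg_eq {w z : ℂ} (hw : 0 < w.re) (hz : 0 < z.re) :
    ∫ t : ℝ in Ioi 0, (t : ℂ) ^ (w - 1) * Complex.exp (-(z * t)) =
      Complex.Gamma w * Complex.exp (-w * Complex.log z) := by
  set U : Set ℂ := {z | 0 < z.re} with hU
  have hUo : IsOpen U := isOpen_lt continuous_const continuous_re
  have hUc : IsPreconnected U := (convex_halfSpace_re_gt 0).isPreconnected
  have hd : DifferentiableOn ℂ
      (fun z : ℂ => ∫ t : ℝ in Ioi 0, (t : ℂ) ^ (w - 1) * Complex.exp (-(z * t))) U := by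
    intro z hz
    have hz' : 0 < z.re := hz
    have hb := integrableOn_rpow_mul_exp_neg_mul_rpow (s := w.re) (p := 1) (b := z.re / 2)
      (by linarith) one_pos (by linarith)
    rw [IntegrableOn] at hb
    have hnhds : {y : ℂ | z.re / 2 < y.re} ∈ 𝓝 z :=
      (isOpen_lt continuous_const continuous_re).mem_nhds (by simp; linarith)
    refine (hasDerivAt_integral_of_dominated_loc_of_deriv_le (𝕜 := ℂ)
      (μ := volume.restrict (Ioi (0 : ℝ))) hnhds
      (F' := fun y t => (t : ℂ) ^ (w - 1) * (Complex.exp (-(y * t)) * -(t : ℂ))) ?_ ?_ ?_ ?_ hb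
      ?_).2.differentiableAt.differentiableWithinAt
    · filter_upwards [hUo.mem_nhds hz] with y hy
      exact (integrableOn_cpow_mul_exp_neg hw hy).aestronglyMeasurable
    · exact integrableOn_cpow_mul_exp_neg hw hz
    · refine ContinuousOn.aestronglyMeasurable (fun t ht => ContinuousAt.continuousWithinAt ?_)
        measurableSet_Ioi
      refine ContinuousAt.mul ?_ (by fun_prop)
      exact continuousAt_ofReal_cpow_const _ _ (Or.inr (mem_Ioi.1 ht).ne')
    · refine (ae_restrict_iff' measurableSet_Ioi).2 (Eventually.of_forall fun t ht y hy => ?_)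
      have ht0 : 0 < t := ht
      rw [norm_mul, Complex.norm_cpow_eq_rpow_re_of_pos ht, norm_mul, Complex.norm_exp, norm_neg,
        Complex.norm_real, Real.norm_of_nonneg ht0.le]
      have h1 : t ^ (w - 1).re * t = t ^ w.re := by
        rw [Complex.sub_re, Complex.one_re, Real.rpow_sub_one ht0.ne']
        field_simp
      have h2 : (-(y * (t : ℂ))).re ≤ -(z.re / 2) * t ^ (1 : ℝ) := by
        have hy' : z.re / 2 < y.re := hy
        simp
        nlinarith
      calc _ = t ^ w.re * Real.exp (-(y * (t : ℂ))).re := by rw [← h1]; ring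
        _ ≤ _ := by gcongr
    · refine Eventually.of_forall fun t y _ => ?_
      refine HasDerivAt.const_mul _ ?_
      exact ((hasDerivAt_mul_const (t : ℂ)).fun_neg).cexp
  have hd2 : DifferentiableOn ℂ (fun z : ℂ => Complex.Gamma w * Complex.exp (-w * Complex.log z))
      U := by
    intro z hz
    have : z ∈ Complex.slitPlane := Or.inl hz
    exact (((differentiableAt_id.clog this).const_mul _).cexp.const_mul
      _).differentiableWithinAt
  refine AnalyticOnNhd.eqOn_of_preconnected_of_frequently_eq (hd.analyticOnNhd hUo)
    (hd2.analyticOnNhd hUo) hUc (z₀ := 1) (by simp [hU]) ?_ hz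
  -- the two sides agree at the positive reals, which accumulate at `1`
  have hfreq : ∃ᶠ x : ℝ in 𝓝[≠] (1 : ℝ), 0 < x :=
    (eventually_nhdsWithin_of_eventually_nhds (lt_mem_nhds one_pos)).frequently
  have hmap : Tendsto (fun x : ℝ => (x : ℂ)) (𝓝[≠] (1 : ℝ)) (𝓝[≠] (1 : ℂ)) := by
    refine tendsto_nhdsWithin_of_tendsto_nhds_of_eventually_within _ ?_ ?_
    · exact (Complex.continuous_ofReal.tendsto' 1 1 (by simp)).mono_left nhdsWithin_le_nhds
    · filter_upwards [self_mem_nhdsWithin] with x hx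
      simpa using hx
  refine hmap.frequently (hfreq.mono fun x hx => ?_)
  rw [Complex.integral_cpow_mul_exp_neg_mul_Ioi hw hx, mul_comm]
  congr 1
  have hx' : (x : ℂ) ≠ 0 := by exact_mod_cast hx.ne'
  have harg : (x : ℂ).arg ≠ Real.pi := by
    rw [Complex.arg_ofReal_of_nonneg hx.le]; exact Real.pi_ne_zero.symm
  rw [one_div, Complex.cpow_def_of_ne_zero (inv_ne_zero hx'), Complex.log_inv _ harg]
  congr 1
  ring

/-- Take absolute values inside Euler's integral for `Γ(w) v ^ (-w)`. -/
lemma norm_Gamma_mul_exp_le {w v : ℂ} (hw : 0 < w.re) (hv : 0 < v.re) :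
    ‖Complex.Gamma w * Complex.exp (-w * Complex.log v)‖ ≤
      (1 / v.re) ^ w.re * Real.Gamma w.re := by
  rw [← integral_cpow_mul_exp_neg_eq hw hv, ← Real.integral_rpow_mul_exp_neg_mul_Ioi hw hv]
  refine (MeasureTheory.norm_integral_le_integral_norm _).trans (le_of_eq ?_)
  refine MeasureTheory.setIntegral_congr_fun measurableSet_Ioi fun t ht => ?_
  rw [norm_mul, Complex.norm_cpow_eq_rpow_re_of_pos ht, Complex.norm_exp]
  simp

open Filter Topology in
/-- For `Re z > 0` the function `Γ(w) z ^ (-w)` decays exponentially on vertical strips: compare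
it with `Γ(w) v ^ (-w)` for `v = z exp (± i ε)`, which is still in the right half plane. -/
lemma exists_norm_Gamma_mul_exp_le {z : ℂ} (hz : 0 < z.re) :
    ∃ ε C : ℝ, 0 < ε ∧ 0 ≤ C ∧ ∀ w : ℂ, 1 ≤ w.re → w.re ≤ 4 →
      ‖Complex.Gamma w * Complex.exp (-w * Complex.log z)‖ ≤ C * Real.exp (-ε * |w.im|) := by
  have hz0 : z ≠ 0 := by rintro rfl; simp at hz
  have harg : |z.arg| < Real.pi / 2 := Complex.abs_arg_lt_pi_div_two_iff.2 (Or.inl hz)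
  obtain ⟨ε, hε, hε'⟩ : ∃ ε : ℝ, 0 < ε ∧ ε < Real.pi / 2 - |z.arg| :=
    exists_between (sub_pos.2 harg)
  have hrot : ∀ τ : ℝ, |τ| ≤ ε → 0 < (z * Complex.exp (τ * I)).re ∧
      Complex.log (z * Complex.exp (τ * I)) = Complex.log z + τ * I := by
    intro τ hτ
    have h1 := abs_lt.1 (lt_of_le_of_lt (abs_add_le z.arg τ)
      (by linarith : |z.arg| + |τ| < Real.pi / 2))
    have hlog : Complex.log (z * Complex.exp (τ * I)) = Complex.log z + τ * I := by
      have e : z * Complex.exp (τ * I) = Complex.exp (Complex.log z + τ * I) := by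
        rw [Complex.exp_add, Complex.exp_log hz0]
      rw [e, Complex.log_exp]
      · simp [Complex.log_im]; linarith [Real.pi_pos]
      · simp [Complex.log_im]; linarith [Real.pi_pos]
    refine ⟨?_, hlog⟩
    have h2 : |(z * Complex.exp (τ * I)).arg| < Real.pi / 2 := by
      have := congrArg Complex.im hlog
      simp [Complex.log_im] at this
      rw [this]; exact abs_lt.2 h1
    rcases Complex.abs_arg_lt_pi_div_two_iff.1 h2 with h | h
    · exact h
    · exact absurd h (mul_ne_zero hz0 (Complex.exp_ne_zero _))
  have hbd : ∀ τ : ℝ, |τ| ≤ ε → ∃ C : ℝ, 0 ≤ C ∧ ∀ w : ℂ, 1 ≤ w.re → w.re ≤ 4 →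
      ‖Complex.Gamma w * Complex.exp (-w * Complex.log z)‖ ≤ C * Real.exp (-(τ * w.im)) := by
    intro τ hτ
    obtain ⟨hpos, hlog⟩ := hrot τ hτ
    set r := (z * Complex.exp (τ * I)).re with hr
    have hcont : ContinuousOn (fun x : ℝ => (1 / r) ^ x * Real.Gamma x) (Set.Icc 1 4) := by
      intro x hx
      refine ContinuousAt.continuousWithinAt (ContinuousAt.mul ?_ ?_)
      · exact Real.continuousAt_const_rpow (by positivity)
      · refine (Real.differentiableAt_Gamma fun m h => ?_).continuousAt
        have := hx.1
        have hm : (0 : ℝ) ≤ m := m.cast_nonneg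
        linarith
    obtain ⟨C, hC⟩ := isCompact_Icc.exists_bound_of_continuousOn hcont
    refine ⟨C, (norm_nonneg _).trans (hC 1 (by norm_num)), fun w h1 h4 => ?_⟩
    have h2 := (norm_Gamma_mul_exp_le (by linarith : 0 < w.re) hpos).trans
      ((le_abs_self _).trans (hC w.re ⟨h1, h4⟩))
    have e : Complex.Gamma w * Complex.exp (-w * Complex.log z) =
        Complex.Gamma w * Complex.exp (-w * Complex.log (z * Complex.exp (τ * I))) *
        Complex.exp (w * (τ * I)) := by
      rw [hlog, mul_assoc, ← Complex.exp_add]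
      congr 2
      ring
    rw [e, norm_mul, Complex.norm_exp (w * (τ * I))]
    have e2 : (w * ((τ : ℂ) * I)).re = -(τ * w.im) := by simp; ring
    rw [e2]
    gcongr
  obtain ⟨C₁, hC₁, h₁⟩ := hbd ε (by rw [abs_of_pos hε])
  obtain ⟨C₂, hC₂, h₂⟩ := hbd (-ε) (by rw [abs_neg, abs_of_pos hε])
  refine ⟨ε, C₁ + C₂, hε, by positivity, fun w hw1 hw4 => ?_⟩
  rcases le_total 0 w.im with h | h
  · rw [abs_of_nonneg h]
    refine (h₁ w hw1 hw4).trans ?_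
    rw [neg_mul]
    gcongr
    linarith
  · rw [abs_of_nonpos h]
    refine (h₂ w hw1 hw4).trans ?_
    rw [neg_mul, neg_neg, neg_mul_neg]
    gcongr
    linarith

open MeasureTheory in
lemma continuous_Gamma_two_add_mul_exp (c : ℂ) :
    Continuous fun t : ℝ => Complex.Gamma (2 + I * t) * Complex.exp (-(2 + I * t) * c) := by
  refine continuous_iff_continuousAt.2 fun t => ContinuousAt.mul ?_ (by fun_prop)
  refine ContinuousAt.comp (f := fun t : ℝ => (2 : ℂ) + I * t) ?_ (by fun_prop)
  refine (Complex.differentiableAt_Gamma _ fun m h => ?_).continuousAt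
  have := congrArg re h
  simp at this
  have hm : (0 : ℝ) ≤ m := m.cast_nonneg
  linarith

open MeasureTheory in
lemma integrable_Gamma_two_add_mul_exp {z : ℂ} (hz : 0 < z.re) :
    Integrable fun t : ℝ =>
      Complex.Gamma (2 + I * t) * Complex.exp (-(2 + I * t) * Complex.log z) := by
  obtain ⟨ε, C, hε, hC, h⟩ := exists_norm_Gamma_mul_exp_le hz
  refine ((integrable_exp_neg_mul_abs hε).const_mul C).mono'
    (continuous_Gamma_two_add_mul_exp _).aestronglyMeasurable (Filter.Eventually.of_forall
      fun t => ?_)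
  simpa using h (2 + I * t) (by simp) (by simp; norm_num)

open MeasureTheory Set in
/-- The Cahen–Mellin integral for the exponential function. -/
lemma exp_neg_mul_eq_integral {z : ℂ} (hz : 0 < z.re) {x : ℝ} (hx : 0 < x) :
    Complex.exp (-(z * x)) = (1 / (2 * Real.pi)) * ∫ t : ℝ, Complex.Gamma (2 + I * t) *
      Complex.exp (-(2 + I * t) * Complex.log z) * Complex.exp (-(2 + I * t) * Real.log x) := by
  set f : ℝ → ℂ := fun t => Complex.exp (-(z * t)) with hf
  have hm : ∀ w : ℂ, 0 < w.re → mellin f w = Complex.Gamma w * Complex.exp (-w * Complex.log z) :=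
    fun w hw => integral_cpow_mul_exp_neg_eq hw hz
  have hre : ∀ t : ℝ, (((2 : ℝ) : ℂ) + t * I) = 2 + I * t := fun t => by push_cast; ring
  have h := mellinInv_mellin_eq 2 f hx (integrableOn_cpow_mul_exp_neg (by simp) hz) ?_
    (by fun_prop)
  · rw [mellinInv] at h
    change f x = _
    rw [← h, Complex.real_smul]
    push_cast
    congr 1
    refine integral_congr_ae (Filter.Eventually.of_forall fun t => ?_)
    simp only
    have hx' : (x : ℂ) ≠ 0 := by exact_mod_cast hx.ne'
    rw [show (2 : ℂ) + t * I = 2 + I * t by ring, hm _ (by simp), smul_eq_mul,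
      Complex.cpow_def_of_ne_zero hx', ← Complex.ofReal_log hx.le, mul_comm]
    congr 2
    ring
  · refine (integrable_Gamma_two_add_mul_exp hz).congr (Filter.Eventually.of_forall fun t => ?_)
    simp only
    rw [hre, hm _ (by simp)]

/-! ### The Mellin integral of the exponential series -/

/-- The integrand `Γ(w) F(w) z ^ (-w)` of the Mellin integral for `∑ a(n) exp (-n z)`. -/
noncomputable def mellinIntegrand (F : ℂ → ℂ) (z w : ℂ) : ℂ :=
  Complex.Gamma w * F w * Complex.exp (-w * Complex.log z)

/-- At `n = 0` the left side is zero by convention, hence the hypothesis on `a 0`. -/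
lemma LSeries_term_eq_mul_exp {a : ℕ → ℂ} (ha0 : a 0 = 0) (s : ℂ) (n : ℕ) :
    LSeries.term a s n = a n * Complex.exp (-s * Real.log n) := by
  rcases eq_or_ne n 0 with rfl | hn
  · simp [ha0]
  · have hn' : (n : ℂ) ≠ 0 := by exact_mod_cast hn
    rw [LSeries.term_of_ne_zero hn, Complex.cpow_def_of_ne_zero hn', div_eq_mul_inv,
      ← Complex.exp_neg, Complex.natCast_log]
    congr 2
    ring

open MeasureTheory Filter in
/-- The Mellin integral of the exponential generating series. -/
lemma IsExtendedSelberg.tsum_exp_eq_integral {d : ℝ} {a : ℕ → ℂ} {F : ℂ → ℂ}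
    (hF : IsExtendedSelberg d a F) (ha0 : a 0 = 0) {z : ℂ} (hz : 0 < z.re) :
    Integrable (fun t : ℝ => mellinIntegrand F z (2 + I * t)) ∧
    ∑' n : ℕ, a n * Complex.exp (-(z * n)) =
      (1 / (2 * Real.pi)) * ∫ t : ℝ, mellinIntegrand F z (2 + I * t) := by
  set K : ℝ → ℂ := fun t =>
    Complex.Gamma (2 + I * t) * Complex.exp (-(2 + I * t) * Complex.log z) with hK
  have hKi : Integrable K := integrable_Gamma_two_add_mul_exp hz
  have hsum2 : LSeriesSummable a 2 := hF.summable 2 (by simp)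
  set f : ℕ → ℝ → ℂ := fun n t => K t * LSeries.term a (2 + I * t) n with hf
  have hnorm : ∀ n t, ‖f n t‖ = ‖K t‖ * ‖LSeries.term a 2 n‖ := fun n t => by
    simp only [hf, norm_mul, LSeries.norm_term_eq]
    simp
  have hfi : ∀ n, Integrable (f n) := fun n => by
    refine (hKi.norm.mul_const ‖LSeries.term a 2 n‖).mono' ?_
      (Eventually.of_forall fun t => (hnorm n t).le)
    refine Continuous.aestronglyMeasurable ((continuous_Gamma_two_add_mul_exp _).mul ?_)
    simp only [LSeries_term_eq_mul_exp ha0]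
    fun_prop
  have hs : Summable fun n => ∫ t, ‖f n t‖ := by
    simp only [hnorm, integral_mul_const]
    exact hsum2.norm.mul_left _
  have hF2 : ∀ t : ℝ, ∑' n, f n t = mellinIntegrand F z (2 + I * t) := fun t => by
    simp only [hf, hK]
    rw [tsum_mul_left, mellinIntegrand, hF.eq_LSeries _ (by simp), LSeries]
    ring
  constructor
  · have hM := hKi.norm.mul_const (∑' n, ‖LSeries.term a 2 n‖)
    refine hM.mono' ?_ (Eventually.of_forall fun t => ?_)
    · simp only [← hF2]
      have hc : Continuous fun t : ℝ => ∑' n, LSeries.term a (2 + I * t) n := by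
        refine continuous_tsum (fun n => ?_) hsum2.norm fun n t => le_of_eq ?_
        · simp only [LSeries_term_eq_mul_exp ha0]
          fun_prop
        · simp [LSeries.norm_term_eq]
      simp only [hf, tsum_mul_left]
      exact ((continuous_Gamma_two_add_mul_exp _).mul hc).aestronglyMeasurable
    · rw [mellinIntegrand, mul_right_comm, norm_mul]
      gcongr
      rw [hF.eq_LSeries _ (by simp)]
      exact LSeries_norm_le hsum2 (by simp)
  · have h := (hasSum_integral_of_summable_integral_norm hfi hs).tsum_eq
    simp only [hF2] at h
    rw [← h, ← tsum_mul_left]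
    refine tsum_congr fun n => ?_
    rcases eq_or_ne n 0 with rfl | hn
    · simp [hf, ha0]
    · have hn' : (0 : ℝ) < n := by exact_mod_cast Nat.pos_of_ne_zero hn
      have h1 := exp_neg_mul_eq_integral hz hn'
      simp only [Complex.ofReal_natCast] at h1
      rw [h1, mul_left_comm, ← integral_const_mul]
      congr 1
      refine integral_congr_ae (Eventually.of_forall fun t => ?_)
      simp only [hf, hK, LSeries_term_eq_mul_exp ha0]
      ring

open Filter Topology in
lemma exists_pow_mul_exp_le (k : ℕ) {ε : ℝ} (hε : 0 < ε) :
    ∃ C : ℝ, 0 ≤ C ∧ ∀ x : ℝ, 0 ≤ x → (5 + x) ^ k * Real.exp (-ε * x) ≤ C := by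
  refine ⟨k.factorial * (1 / ε) ^ k * Real.exp (5 * ε), by positivity, fun x hx => ?_⟩
  have h := Real.pow_div_factorial_le_exp (ε * (5 + x)) (by positivity) k
  rw [div_le_iff₀ (by positivity), mul_pow] at h
  have h2 : Real.exp (ε * (5 + x)) * Real.exp (-ε * x) = Real.exp (5 * ε) := by
    rw [← Real.exp_add]; congr 1; ring
  have hek : (1 / ε) ^ k * ε ^ k = 1 := by rw [← mul_pow, one_div_mul_cancel hε.ne', one_pow]
  calc (5 + x) ^ k * Real.exp (-ε * x)
      = (1 / ε) ^ k * (ε ^ k * (5 + x) ^ k) * Real.exp (-ε * x) := by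
        rw [← mul_assoc, hek, one_mul]
    _ ≤ (1 / ε) ^ k * (Real.exp (ε * (5 + x)) * k.factorial) * Real.exp (-ε * x) := by gcongr
    _ = _ := by rw [← h2]; ring

/-- Exponential decay of the Mellin integrand in the strip `-1 ≤ Re w ≤ 2`. -/
lemma IsExtendedSelberg.exists_norm_mellinIntegrand_le {a : ℕ → ℂ} {F : ℂ → ℂ}
    (hF : IsExtendedSelberg 1 a F) {z : ℂ} (hz : 0 < z.re) :
    ∃ ε C : ℝ, 0 < ε ∧ 0 ≤ C ∧ ∀ w : ℂ, -1 ≤ w.re → w.re ≤ 2 → 1 ≤ |w.im| →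
      ‖mellinIntegrand F z w‖ ≤ C * Real.exp (-ε * |w.im|) := by
  obtain ⟨ε, C, hε, hC, h⟩ := exists_norm_Gamma_mul_exp_le hz
  obtain ⟨A, k, hA, hA'⟩ := hF.exists_norm_le
  obtain ⟨D, hD, hD'⟩ := exists_pow_mul_exp_le k (half_pos hε)
  have hz0 : z ≠ 0 := by rintro rfl; simp at hz
  refine ⟨ε / 2, C * ‖z‖ ^ 2 * A * D, half_pos hε, by positivity, fun w h1 h2 him => ?_⟩
  have hw : 1 ≤ ‖w‖ := him.trans (Complex.abs_im_le_norm w)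
  have hw1 : 1 ≤ ‖w + 1‖ := him.trans (by simpa using Complex.abs_im_le_norm (w + 1))
  have hw0 : w ≠ 0 := by rintro rfl; simp at hw; norm_num at hw
  have hw10 : w + 1 ≠ 0 := by intro h; rw [h] at hw1; simp at hw1; norm_num at hw1
  have hG : Complex.Gamma (w + 2) = (w + 1) * w * Complex.Gamma w := by
    rw [show w + 2 = w + 1 + 1 by ring, Complex.Gamma_add_one _ hw10, Complex.Gamma_add_one _ hw0]
    ring
  have hE : Complex.exp (-w * Complex.log z) =
      Complex.exp (-(w + 2) * Complex.log z) * z ^ 2 := by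
    conv_rhs => rw [← Complex.exp_log hz0, ← Complex.exp_nat_mul, Complex.log_exp
      (Complex.neg_pi_lt_log_im z) (Complex.log_im_le_pi z)]
    rw [← Complex.exp_add]
    congr 1
    push_cast
    ring
  have h3 := h (w + 2) (by simp; linarith) (by simp; linarith)
  simp only [Complex.add_im, Complex.im_ofNat, add_zero] at h3
  have h4 : ‖Complex.Gamma w * Complex.exp (-w * Complex.log z)‖ ≤
      C * ‖z‖ ^ 2 * Real.exp (-ε * |w.im|) := by
    rw [hE, ← mul_assoc, norm_mul, norm_pow]
    have : ‖Complex.Gamma w * Complex.exp (-(w + 2) * Complex.log z)‖ ≤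
        C * Real.exp (-ε * |w.im|) := by
      refine le_trans ?_ h3
      rw [hG, norm_mul, norm_mul, norm_mul, norm_mul]
      gcongr
      refine le_mul_of_one_le_left (norm_nonneg _) (one_le_mul_of_one_le_of_one_le hw1 hw)
    calc _ ≤ (C * Real.exp (-ε * |w.im|)) * ‖z‖ ^ 2 := by gcongr
      _ = _ := by ring
  have h5 : ‖w + 3‖ ≤ 5 + |w.im| := by
    refine (Complex.norm_le_abs_re_add_abs_im _).trans ?_
    simp only [Complex.add_re, Complex.re_ofNat, Complex.add_im, Complex.im_ofNat, add_zero]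
    gcongr
    exact abs_le.2 ⟨by linarith, by linarith⟩
  have h6 := hD' |w.im| (abs_nonneg _)
  have h7 : Real.exp (-ε * |w.im|) =
      Real.exp (-(ε / 2) * |w.im|) * Real.exp (-(ε / 2) * |w.im|) := by
    rw [← Real.exp_add]; congr 1; ring
  rw [mellinIntegrand, mul_right_comm, norm_mul]
  calc _ ≤ (C * ‖z‖ ^ 2 * Real.exp (-ε * |w.im|)) * (A * (5 + |w.im|) ^ k) :=
        mul_le_mul h4 ((hA' w h1 h2 him).trans (by gcongr)) (norm_nonneg _) (by positivity)
    _ = C * ‖z‖ ^ 2 * A * ((5 + |w.im|) ^ k * Real.exp (-(ε / 2) * |w.im|)) *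
        Real.exp (-(ε / 2) * |w.im|) := by rw [h7]; ring
    _ ≤ _ := by gcongr

lemma IsExtendedSelberg.differentiableAt {d : ℝ} {a : ℕ → ℂ} {F : ℂ → ℂ}
    (hF : IsExtendedSelberg d a F) {s : ℂ} (hs : s ≠ 1) : DifferentiableAt ℂ F s := by
  obtain ⟨m, E, hE, hEF⟩ := hF.continuation
  have h : DifferentiableAt ℂ (fun s => E s / (s - 1) ^ m) s :=
    (hE.1 s).div (by fun_prop) (pow_ne_zero _ (sub_ne_zero.2 hs))
  refine h.congr_of_eventuallyEq ?_
  filter_upwards [isOpen_ne.mem_nhds hs] with w hw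
  rw [hEF w hw, mul_div_cancel_left₀ _ (pow_ne_zero _ (sub_ne_zero.2 hw))]

lemma IsExtendedSelberg.differentiableAt_mellinIntegrand {d : ℝ} {a : ℕ → ℂ} {F : ℂ → ℂ}
    (hF : IsExtendedSelberg d a F) (z : ℂ) {w : ℂ} (hw : w.im ≠ 0) :
    DifferentiableAt ℂ (mellinIntegrand F z) w := by
  refine ((Complex.differentiableAt_Gamma _ fun m h => hw ?_).mul
    (hF.differentiableAt fun h => hw ?_)).mul (by fun_prop)
  · rw [h]; simp
  · rw [h]; simp

open MeasureTheory Filter Topology Set in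
/-- Moving the part of the line of integration above height `T` from `Re w = 2` to `Re w = -1`
meets no pole. -/
lemma IsExtendedSelberg.integral_Ioi_mellinIntegrand {a : ℕ → ℂ} {F : ℂ → ℂ}
    (hF : IsExtendedSelberg 1 a F) {z : ℂ} (hz : 0 < z.re) {T : ℝ} (hT : 1 ≤ T) :
    ∫ t in Ioi T, mellinIntegrand F z (2 + I * t) =
      (∫ t in Ioi T, mellinIntegrand F z (-1 + I * t)) +
        I * ∫ x in (-1 : ℝ)..2, mellinIntegrand F z (x + I * T) := by
  obtain ⟨ε, C, hε, hC, hb⟩ := hF.exists_norm_mellinIntegrand_le hz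
  set f := mellinIntegrand F z with hf
  have hint : ∀ σ : ℝ, -1 ≤ σ → σ ≤ 2 → IntegrableOn (fun t : ℝ => f (σ + I * t)) (Ioi T) := by
    intro σ h1 h2
    refine (((integrable_exp_neg_mul_abs hε).const_mul C).integrableOn (s := Ioi T)).mono' ?_ ?_
    · refine ContinuousOn.aestronglyMeasurable (fun t ht => ContinuousAt.continuousWithinAt ?_)
        measurableSet_Ioi
      have ht' : T < t := ht
      refine ContinuousAt.comp (f := fun t : ℝ => (σ : ℂ) + I * t)
        (hF.differentiableAt_mellinIntegrand z ?_).continuousAt (by fun_prop)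
      simp; linarith
    · refine (ae_restrict_iff' measurableSet_Ioi).2 (Eventually.of_forall fun t ht => ?_)
      have ht' : T < t := ht
      have := hb (σ + I * t) (by simpa using h1) (by simpa using h2)
        (by simp; exact (by linarith : 1 ≤ t).trans (le_abs_self t))
      simpa using this
  have hA := intervalIntegral_tendsto_integral_Ioi T (hint 2 (by norm_num) le_rfl) tendsto_id
  have hB := intervalIntegral_tendsto_integral_Ioi T (hint (-1) le_rfl (by norm_num)) tendsto_id
  have hH : Tendsto (fun Y : ℝ => ∫ x in (-1 : ℝ)..2, f (x + I * Y)) atTop (𝓝 0) := by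
    have hlim : Tendsto (fun Y : ℝ => C * Real.exp (-ε * Y) * |2 - (-1)|) atTop (𝓝 0) := by
      have : Tendsto (fun Y : ℝ => Real.exp (-ε * Y)) atTop (𝓝 0) := by
        refine Real.tendsto_exp_atBot.comp ?_
        exact tendsto_id.const_mul_atTop_of_neg (by linarith)
      simpa using (this.const_mul C).mul_const |(2 : ℝ) - (-1)|
    refine squeeze_zero_norm' ?_ hlim
    filter_upwards [eventually_ge_atTop 1] with Y hY
    refine intervalIntegral.norm_integral_le_of_norm_le_const fun x hx => ?_
    rw [uIoc_of_le (by norm_num)] at hx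
    have := hb (x + I * Y) (by simpa using hx.1.le) (by simpa using hx.2)
      (by simp; exact hY.trans (le_abs_self Y))
    simpa [abs_of_nonneg (zero_le_one.trans hY)] using this
  have hrect : ∀ Y : ℝ, T ≤ Y → ∫ t in T..Y, f (2 + I * t) =
      (∫ t in T..Y, f (-1 + I * t)) + I * (∫ x in (-1 : ℝ)..2, f (x + I * T)) -
        I * ∫ x in (-1 : ℝ)..2, f (x + I * Y) := by
    intro Y hY
    have := Complex.integral_boundary_rect_eq_zero_of_differentiableOn f (-1 + I * T) (2 + I * Y)
      (fun w hw => by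
        refine (hF.differentiableAt_mellinIntegrand z ?_).differentiableWithinAt
        have := hw.2
        simp [uIcc_of_le hY] at this
        linarith [this.1])
    simp only [add_re, neg_re, one_re, mul_re, I_re, zero_mul, ofReal_re, I_im, ofReal_im, mul_zero,
      sub_self, add_zero, add_im, neg_im, one_im, mul_im, zero_add, neg_zero, one_mul, re_ofNat,
      im_ofNat, ofReal_neg, ofReal_one, ofReal_ofNat, smul_eq_mul, mul_comm _ I] at this
    linear_combination (-I) * this + ((∫ t in T..Y, f (2 + I * t)) -
      ∫ t in T..Y, f (-1 + I * t)) * Complex.I_sq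
  simp only [ofReal_neg, ofReal_one, ofReal_ofNat, id] at hA hB
  have hR := (hB.add_const (I * ∫ x in (-1 : ℝ)..2, f (x + I * T))).sub (hH.const_mul I)
  rw [mul_zero, sub_zero] at hR
  refine tendsto_nhds_unique hA (hR.congr' ?_)
  filter_upwards [eventually_ge_atTop T] with Y hY
  rw [hrect Y hY]

/-! ### Laplace integrals with small damping -/

section

open MeasureTheory Set Filter Topology in
/-- An Abelian lemma: the Laplace transform of a function vanishing at infinity is `o(1/u)` as
`u → 0`. -/
lemma tendsto_mul_laplace_of_tendsto_zero {g : ℝ → ℝ} {T B : ℝ} (hT : 0 ≤ T)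
    (hg : ContinuousOn g (Ioi T)) (hB : ∀ t, T < t → ‖g t‖ ≤ B) (h0 : Tendsto g atTop (𝓝 0)) :
    Tendsto (fun u : ℝ => u * ∫ t in Ioi T, g t * Real.exp (-(u * t))) (𝓝[>] 0) (𝓝 0) := by
  set G : ℝ → ℝ := (Ioi T).indicator g with hG
  have hGm : AEStronglyMeasurable G volume :=
    (aestronglyMeasurable_indicator_iff measurableSet_Ioi).2
      (hg.aestronglyMeasurable measurableSet_Ioi)
  have hB0 : 0 ≤ B := (norm_nonneg _).trans (hB (T + 1) (by linarith))
  have hGB : ∀ t, ‖G t‖ ≤ B := fun t => by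
    by_cases ht : t ∈ Ioi T
    · simpa [hG, ht] using hB t ht
    · simpa [hG, ht] using hB0
  have hG0 : Tendsto G atTop (𝓝 0) := by
    refine h0.congr' ?_
    filter_upwards [eventually_gt_atTop T] with t ht
    simp [hG, ht]
  -- rescale the variable of integration
  have hsub : ∀ u : ℝ, 0 < u → u * ∫ t in Ioi T, g t * Real.exp (-(u * t)) =
      ∫ s in Ioi (0 : ℝ), G (u⁻¹ * s) * Real.exp (-s) := by
    intro u hu
    have h1 : ∫ t in Ioi T, g t * Real.exp (-(u * t)) =
        ∫ t in Ioi (0 : ℝ), G t * Real.exp (-(u * t)) := by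
      rw [← integral_indicator measurableSet_Ioi, ← integral_indicator measurableSet_Ioi]
      congr 1
      ext t
      by_cases ht : t ∈ Ioi T
      · have ht0 : t ∈ Ioi (0 : ℝ) := hT.trans_lt ht
        rw [indicator_of_mem ht, indicator_of_mem ht0, hG, indicator_of_mem ht]
      · rw [indicator_of_notMem ht]
        have hGt : G t = 0 := by rw [hG, indicator_of_notMem ht]
        by_cases ht0 : t ∈ Ioi (0 : ℝ)
        · rw [indicator_of_mem ht0, hGt, zero_mul]
        · rw [indicator_of_notMem ht0]
    rw [h1]
    have h2 := integral_comp_mul_left_Ioi (fun t => G t * Real.exp (-(u * t))) 0 (inv_pos.2 hu)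
    rw [mul_zero, inv_inv, smul_eq_mul] at h2
    rw [← h2]
    refine setIntegral_congr_fun measurableSet_Ioi fun s _ => ?_
    rw [mul_inv_cancel_left₀ hu.ne']
  have hlim : Tendsto (fun u : ℝ => ∫ s in Ioi (0 : ℝ), G (u⁻¹ * s) * Real.exp (-s)) (𝓝[>] 0)
      (𝓝 (∫ s in Ioi (0 : ℝ), (0 : ℝ))) := by
    refine tendsto_integral_filter_of_dominated_convergence (fun s => B * Real.exp (-s)) ?_ ?_ ?_ ?_
    · filter_upwards [self_mem_nhdsWithin] with u hu
      have hq : Measure.QuasiMeasurePreserving (fun s : ℝ => u⁻¹ * s) volume volume :=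
        Measure.quasiMeasurePreserving_smul volume (inv_ne_zero (ne_of_gt hu))
      exact ((hGm.comp_quasiMeasurePreserving hq).mul
        (by fun_prop : Continuous fun s : ℝ => Real.exp (-s)).aestronglyMeasurable).restrict
    · refine Eventually.of_forall fun u => Eventually.of_forall fun s => ?_
      rw [norm_mul, Real.norm_of_nonneg (Real.exp_pos _).le]
      gcongr
      exact hGB _
    · exact (by simpa using exp_neg_integrableOn_Ioi 0 one_pos :
        IntegrableOn (fun s : ℝ => Real.exp (-s)) (Ioi 0)).const_mul B
    · refine (ae_restrict_iff' measurableSet_Ioi).2 (Eventually.of_forall fun s hs => ?_)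
      have : Tendsto (fun u : ℝ => u⁻¹ * s) (𝓝[>] 0) atTop :=
        tendsto_inv_nhdsGT_zero.atTop_mul_const hs
      simpa using (hG0.comp this).mul_const (Real.exp (-s))
  rw [integral_zero] at hlim
  refine hlim.congr' ?_
  filter_upwards [self_mem_nhdsWithin] with u hu
  exact (hsub u hu).symm

/-- The integrand `h(t) t ^ (iθ) exp (i x t) exp (-ν t)` of an oscillating Laplace integral. -/
noncomputable def laplaceIntegrand (h : ℝ → ℂ) (θ x : ℝ) (ν : ℂ) (t : ℝ) : ℂ :=
  h t * Complex.exp (I * θ * Real.log t + I * x * t - ν * t)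

lemma norm_laplaceIntegrand (h : ℝ → ℂ) (θ x : ℝ) (ν : ℂ) (t : ℝ) :
    ‖laplaceIntegrand h θ x ν t‖ = ‖h t‖ * Real.exp (-(ν.re * t)) := by
  rw [laplaceIntegrand, norm_mul, Complex.norm_exp]
  congr 2
  have : I * (θ : ℂ) * (Real.log t : ℂ) + I * x * t - ν * t =
    I * ((θ * Real.log t + x * t : ℝ) : ℂ) - ν * t := by push_cast; ring
  rw [this, Complex.sub_re, Complex.I_mul_re, Complex.ofReal_im, Complex.re_mul_ofReal]
  ring

open MeasureTheory Set Filter Topology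

lemma continuousOn_laplaceIntegrand {h : ℝ → ℂ} {T : ℝ} (hT : 0 ≤ T) (hh : ContinuousOn h (Ioi T))
    (θ x : ℝ) (ν : ℂ) : ContinuousOn (laplaceIntegrand h θ x ν) (Ioi T) := by
  refine hh.mul (Complex.continuous_exp.comp_continuousOn ?_)
  have hl : ContinuousOn (fun t : ℝ => (Real.log t : ℂ)) (Ioi T) :=
    Complex.continuous_ofReal.comp_continuousOn
      (Real.continuousOn_log.mono fun t ht => (hT.trans_lt ht).ne')
  exact ((continuousOn_const.mul hl).add (by fun_prop)).sub (by fun_prop)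

lemma integrableOn_laplaceIntegrand {h : ℝ → ℂ} {T B : ℝ} (hT : 0 ≤ T)
    (hh : ContinuousOn h (Ioi T)) (hB : ∀ t, T < t → ‖h t‖ ≤ B) (θ x : ℝ) {ν : ℂ}
    (hν : 0 < ν.re) : IntegrableOn (laplaceIntegrand h θ x ν) (Ioi T) := by
  refine ((exp_neg_integrableOn_Ioi T hν).const_mul B).mono'
    ((continuousOn_laplaceIntegrand hT hh θ x ν).aestronglyMeasurable measurableSet_Ioi) ?_
  refine (ae_restrict_iff' measurableSet_Ioi).2 (Eventually.of_forall fun t ht => ?_)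
  rw [norm_laplaceIntegrand, neg_mul]
  gcongr
  exact hB t ht

lemma integral_norm_laplaceIntegrand_le {h : ℝ → ℂ} {T B : ℝ} (hT : 0 ≤ T)
    (hh : ContinuousOn h (Ioi T)) (hB : ∀ t, T < t → ‖h t‖ ≤ B) (θ x : ℝ) {ν : ℂ}
    (hν : 0 < ν.re) : ∫ t in Ioi T, ‖laplaceIntegrand h θ x ν t‖ ≤ B / ν.re := by
  have hB0 : 0 ≤ B := (norm_nonneg _).trans (hB (T + 1) (by linarith))
  calc _ ≤ ∫ t in Ioi T, B * Real.exp (-ν.re * t) := by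
        refine setIntegral_mono_on (integrableOn_laplaceIntegrand hT hh hB θ x hν).norm
          ((exp_neg_integrableOn_Ioi T hν).const_mul B) measurableSet_Ioi fun t ht => ?_
        rw [norm_laplaceIntegrand, neg_mul]
        gcongr
        exact hB t ht
    _ = B * (Real.exp (-ν.re * T) / ν.re) := by
        rw [integral_const_mul, integral_exp_mul_Ioi (by linarith)]
        rw [neg_div_neg_eq]
    _ ≤ B * (1 / ν.re) := by
        gcongr
        rw [Real.exp_le_one_iff]
        nlinarith
    _ = _ := by ring

lemma integral_laplaceIntegrand_one (θ x : ℝ) {ν : ℂ} (hν : 0 < ν.re) :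
    ∫ t in Ioi (0 : ℝ), laplaceIntegrand (fun _ => 1) θ x ν t =
      Complex.Gamma (1 + I * θ) * Complex.exp (-(1 + I * θ) * Complex.log (ν - I * x)) := by
  rw [← integral_cpow_mul_exp_neg_eq (by simp) (by simpa using hν)]
  refine setIntegral_congr_fun measurableSet_Ioi fun t ht => ?_
  have ht' : (0 : ℝ) < t := ht
  rw [laplaceIntegrand, one_mul, add_sub_cancel_left,
    Complex.cpow_def_of_ne_zero (by exact_mod_cast ht'.ne'), ← Complex.ofReal_log ht'.le,
    ← Complex.exp_add]
  congr 1
  ring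

lemma norm_exp_I_mul_log (θ u : ℝ) : ‖Complex.exp (I * θ * Real.log u)‖ = 1 := by
  rw [mul_assoc, ← Complex.ofReal_mul, mul_comm, Complex.norm_exp_ofReal_mul_I]

lemma eventually_half_lt_re {ν : ℝ → ℂ} (hν : Tendsto (fun u => ν u / u) (𝓝[>] 0) (𝓝 1)) :
    ∀ᶠ u in 𝓝[>] (0 : ℝ), u / 2 < (ν u).re := by
  have h1 : Tendsto (fun u => (ν u / u).re) (𝓝[>] 0) (𝓝 1) :=
    (Complex.continuous_re.tendsto' 1 1 (by simp)).comp hν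
  filter_upwards [h1.eventually (lt_mem_nhds (by norm_num : (1 / 2 : ℝ) < 1)),
    self_mem_nhdsWithin] with u hu hu0
  have hu0' : (0 : ℝ) < u := hu0
  rw [Complex.div_ofReal_re, lt_div_iff₀ hu0'] at hu
  linarith

/-- The behaviour of the Laplace integral as the damping parameter `ν ∼ u` tends to `0`: it is of
the order of `u ^ (-1 - iθ)` when there is no oscillation (`x = 0`), and smaller otherwise. -/
lemma tendsto_integral_laplaceIntegrand {h : ℝ → ℂ} {T : ℝ} {C : ℂ} (hT : 0 ≤ T) {B : ℝ}
    (hh : ContinuousOn h (Ioi T)) (hB : ∀ t, T < t → ‖h t‖ ≤ B) (hC : Tendsto h atTop (𝓝 C))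
    {ν : ℝ → ℂ} (hν : Tendsto (fun u => ν u / u) (𝓝[>] 0) (𝓝 1)) (θ x : ℝ) :
    Tendsto (fun u : ℝ => u * Complex.exp (I * θ * Real.log u) *
      ∫ t in Ioi T, laplaceIntegrand h θ x (ν u) t) (𝓝[>] 0)
      (𝓝 (if x = 0 then C * Complex.Gamma (1 + I * θ) else 0)) := by
  have hofReal : Tendsto (fun u : ℝ => (u : ℂ)) (𝓝[>] 0) (𝓝 0) :=
    (Complex.continuous_ofReal.tendsto' 0 0 (by simp)).mono_left nhdsWithin_le_nhds
  have hν0 : Tendsto ν (𝓝[>] 0) (𝓝 0) := by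
    have := hν.mul hofReal
    rw [mul_zero] at this
    refine this.congr' ?_
    filter_upwards [self_mem_nhdsWithin] with u hu
    have hu' : (u : ℂ) ≠ 0 := by exact_mod_cast (ne_of_gt hu)
    exact div_mul_cancel₀ _ hu'
  have hre := eventually_half_lt_re hν
  have hphase := norm_exp_I_mul_log θ
  -- the contribution of `h - C`
  have herr : Tendsto (fun u : ℝ => u * Complex.exp (I * θ * Real.log u) *
      ∫ t in Ioi T, laplaceIntegrand (fun t => h t - C) θ x (ν u) t) (𝓝[>] 0) (𝓝 0) := by
    have hz : Tendsto (fun t => ‖h t - C‖) atTop (𝓝 0) := by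
      simpa using (hC.sub_const C).norm
    have h1 := tendsto_mul_laplace_of_tendsto_zero (g := fun t => ‖h t - C‖) (B := B + ‖C‖) hT
      (hh.sub continuousOn_const).norm (fun t ht => by
        rw [norm_norm]
        exact (norm_sub_le _ _).trans (by gcongr; exact hB t ht)) hz
    have h2 : Tendsto (fun u : ℝ => u / 2) (𝓝[>] 0) (𝓝[>] 0) := by
      refine tendsto_nhdsWithin_of_tendsto_nhds_of_eventually_within _ ?_ ?_
      · exact ((continuous_id.div_const 2).tendsto' 0 0 (by simp)).mono_left nhdsWithin_le_nhds
      · filter_upwards [self_mem_nhdsWithin] with u hu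
        exact half_pos (mem_Ioi.1 hu)
    have h3 := (h1.comp h2).const_mul 2
    rw [mul_zero] at h3
    refine squeeze_zero_norm' ?_ h3
    filter_upwards [hre, self_mem_nhdsWithin] with u hu hu0
    have hu0' : (0 : ℝ) < u := hu0
    rw [norm_mul, norm_mul, hphase, mul_one, Complex.norm_real, Real.norm_of_nonneg hu0'.le]
    simp only [Function.comp_def]
    rw [← mul_assoc, mul_div_cancel₀ _ two_ne_zero]
    gcongr
    refine norm_integral_le_of_norm_le ?_ ?_
    · refine (((exp_neg_integrableOn_Ioi T (half_pos hu0')).const_mul (B + ‖C‖))).mono' ?_ ?_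
      · refine ContinuousOn.aestronglyMeasurable ?_ measurableSet_Ioi
        exact (hh.sub continuousOn_const).norm.mul (by fun_prop)
      · refine (ae_restrict_iff' measurableSet_Ioi).2 (Eventually.of_forall fun t ht => ?_)
        rw [norm_mul, norm_norm, Real.norm_of_nonneg (Real.exp_pos _).le, neg_mul]
        gcongr
        exact (norm_sub_le _ _).trans (by gcongr; exact hB t ht)
    · refine (ae_restrict_iff' measurableSet_Ioi).2 (Eventually.of_forall fun t ht => ?_)
      rw [norm_laplaceIntegrand]
      have ht0 : 0 < t := hT.trans_lt ht
      gcongr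
  -- the contribution of `[0, T]`
  have hsmall : Tendsto (fun u : ℝ => u * Complex.exp (I * θ * Real.log u) *
      ∫ t in Ioc 0 T, laplaceIntegrand (fun _ => 1) θ x (ν u) t) (𝓝[>] 0) (𝓝 0) := by
    have h1 : Tendsto (fun u : ℝ => u * T) (𝓝[>] 0) (𝓝 0) :=
      ((continuous_id.mul continuous_const).tendsto' 0 0 (by simp)).mono_left nhdsWithin_le_nhds
    refine squeeze_zero_norm' ?_ h1
    filter_upwards [hre, self_mem_nhdsWithin] with u hu hu0
    have hu0' : (0 : ℝ) < u := hu0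
    rw [norm_mul, norm_mul, hphase, mul_one, Complex.norm_real, Real.norm_of_nonneg hu0'.le]
    gcongr
    have := norm_setIntegral_le_of_norm_le_const (μ := volume) (s := Ioc 0 T)
      (f := laplaceIntegrand (fun _ => 1) θ x (ν u)) (C := 1) (by simp) (fun t ht => by
        rw [norm_laplaceIntegrand, norm_one, one_mul, Real.exp_le_one_iff]
        have := ht.1
        nlinarith)
    simpa [hT] using this
  -- the main contribution
  have hmain : Tendsto (fun u : ℝ => u * Complex.exp (I * θ * Real.log u) *
      (Complex.Gamma (1 + I * θ) * Complex.exp (-(1 + I * θ) * Complex.log (ν u - I * x))))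
      (𝓝[>] 0) (𝓝 (if x = 0 then Complex.Gamma (1 + I * θ) else 0)) := by
    split_ifs with hx
    · have hlog : Tendsto (fun u => Complex.log (ν u / u)) (𝓝[>] 0) (𝓝 0) := by
        simpa using hν.clog (by simp)
      have h1 := ((hlog.const_mul (-(1 + I * θ))).cexp).const_mul (Complex.Gamma (1 + I * θ))
      rw [mul_zero, Complex.exp_zero, mul_one] at h1
      refine h1.congr' ?_
      filter_upwards [hre, self_mem_nhdsWithin] with u hu hu0
      have hu0' : (0 : ℝ) < u := hu0
      have huc : (u : ℂ) ≠ 0 := by exact_mod_cast hu0'.ne'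
      have hνne : ν u ≠ 0 := by
        intro h; rw [h] at hu; simp at hu; linarith
      have e1 : Complex.log (ν u) = Real.log u + Complex.log (ν u / u) := by
        rw [← Complex.log_mul_ofReal u hu0' _ (div_ne_zero hνne huc), div_mul_cancel₀ _ huc]
      have e2 : (u : ℂ) = Complex.exp (Real.log u) := by
        rw [← Complex.ofReal_exp, Real.exp_log hu0']
      rw [hx, Complex.ofReal_zero, mul_zero, sub_zero, e1]
      conv_rhs => enter [1, 1]; rw [e2]
      rw [mul_left_comm, ← Complex.exp_add, ← Complex.exp_add]
      congr 2
      ring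
    · have hne : -(I * (x : ℂ)) ∈ Complex.slitPlane := by
        refine Or.inr ?_
        simpa using hx
      have h1 : Tendsto (fun u => ν u - I * x) (𝓝[>] 0) (𝓝 (-(I * x))) := by
        simpa using hν0.sub_const (I * (x : ℂ))
      have h2 := (((h1.clog hne).const_mul (-(1 + I * θ))).cexp.const_mul
        (Complex.Gamma (1 + I * θ)))
      have h3 : Tendsto (fun u : ℝ => (u : ℂ) * Complex.exp (I * θ * Real.log u)) (𝓝[>] 0)
          (𝓝 0) := by
        rw [tendsto_zero_iff_norm_tendsto_zero] at hofReal ⊢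
        simpa [hphase] using hofReal
      simpa using h3.mul h2
  have htot := (herr.add ((hmain.const_mul C))).sub (hsmall.const_mul C)
  have hval : (0 + C * (if x = 0 then Complex.Gamma (1 + I * θ) else 0)) - C * 0 =
      if x = 0 then C * Complex.Gamma (1 + I * θ) else 0 := by
    split_ifs <;> simp
  rw [hval] at htot
  refine htot.congr' ?_
  filter_upwards [hre, self_mem_nhdsWithin] with u hu hu0
  have hu0' : (0 : ℝ) < u := hu0
  have hνre : 0 < (ν u).re := by linarith
  have hone := integrableOn_laplaceIntegrand (h := fun _ => 1) (B := 1) le_rfl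
    continuousOn_const (by simp) θ x hνre
  have hsplit : ∫ t in Ioi (0 : ℝ), laplaceIntegrand (fun _ => 1) θ x (ν u) t =
      (∫ t in Ioc 0 T, laplaceIntegrand (fun _ => 1) θ x (ν u) t) +
        ∫ t in Ioi T, laplaceIntegrand (fun _ => 1) θ x (ν u) t := by
    rw [← Ioc_union_Ioi_eq_Ioi hT, setIntegral_union Ioc_disjoint_Ioi_same measurableSet_Ioi
      (hone.mono_set Ioc_subset_Ioi_self) (hone.mono_set (Ioi_subset_Ioi hT))]
  have hdiff : ∫ t in Ioi T, laplaceIntegrand (fun t => h t - C) θ x (ν u) t =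
      (∫ t in Ioi T, laplaceIntegrand h θ x (ν u) t) -
        C * ∫ t in Ioi T, laplaceIntegrand (fun _ => 1) θ x (ν u) t := by
    rw [← integral_const_mul, ← integral_sub (integrableOn_laplaceIntegrand hT hh hB θ x hνre)
      ((hone.mono_set (Ioi_subset_Ioi hT)).const_mul C)]
    refine integral_congr_ae (Eventually.of_forall fun t => ?_)
    simp only [laplaceIntegrand]
    ring
  rw [hdiff, ← integral_laplaceIntegrand_one θ x hνre, hsplit]
  ring

end

/-! ### Boundary behaviour of the exponential series -/

section

open MeasureTheory Set Filter Topology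

/-- On `Re w = -1` the factor `z ^ (-w)` with `z = c (u + i)` turns the decay `exp (-πt/2)` of the
kernel into `exp (-ν t)` with `ν = i log (u + i) + π/2`. To first order, `ν` is `u`. -/
lemma tendsto_log_add_I_div :
    Tendsto (fun u : ℝ => (I * Complex.log (u + I) + Real.pi / 2) / u) (𝓝[>] 0) (𝓝 1) := by
  have h1 : HasDerivAt (fun u : ℝ => (u : ℂ) + I) 1 0 :=
    (Complex.ofRealCLM.hasDerivAt (x := (0 : ℝ))).add_const I
  have h2 : HasDerivAt (fun u : ℝ => I * Complex.log (u + I) + Real.pi / 2) 1 0 := by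
    have := ((h1.clog_real (by simp [Complex.mem_slitPlane_iff])).const_mul I).add_const ((Real.pi : ℂ) / 2)
    simpa using this
  rw [hasDerivAt_iff_tendsto_slope] at h2
  refine (h2.mono_left (nhdsWithin_mono 0 fun u hu => (ne_of_gt hu : u ≠ 0))).congr fun u => ?_
  have hz : I * (Real.pi / 2 * I) + (Real.pi : ℂ) / 2 = 0 := by
    linear_combination (Real.pi / 2 : ℂ) * Complex.I_sq
  rw [slope_def_module, Complex.ofReal_zero, zero_add, Complex.log_I, hz, sub_zero, sub_zero,
    Complex.real_smul, Complex.ofReal_inv]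
  ring

lemma log_mul_add_I {c : ℝ} (hc : 0 < c) (u : ℝ) :
    Complex.log (c * (u + I)) = Real.log c + Complex.log (u + I) := by
  rw [mul_comm, Complex.log_mul_ofReal c hc]
  intro h
  simpa using congrArg im h

lemma continuousAt_Gamma_of_im_ne_zero {w : ℂ} (hw : w.im ≠ 0) : ContinuousAt Complex.Gamma w := by
  refine (Complex.differentiableAt_Gamma _ fun m h => hw ?_).continuousAt
  rw [h]; simp

lemma GammaFactor.continuousAt_eval (g : GammaFactor) {s : ℂ} (hs : g.RegularAt s) :
    ContinuousAt g.eval s := by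
  unfold GammaFactor.eval
  refine ContinuousAt.mul ?_ ?_
  · have hQ : (g.Q : ℂ) ≠ 0 := by exact_mod_cast g.Q_pos.ne'
    exact (continuousAt_const_cpow hQ)
  · refine tendsto_finsetProd _ fun j _ => ?_
    refine ContinuousAt.tendsto (x := s)
      (f := fun s => Complex.Gamma ((g.lam j : ℂ) * s + g.mu j)) ?_
    refine ContinuousAt.comp (f := fun s : ℂ => (g.lam j : ℂ) * s + g.mu j)
      (Complex.differentiableAt_Gamma _ fun m => hs j m).continuousAt (by fun_prop)

/-- The shape of the Mellin integrand on the line `Re w = -1`, high above the real axis: the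
functional equation turns it into a Dirichlet series whose terms are Laplace integrands, with an
amplitude `h` which tends to a nonzero limit. -/
lemma IsExtendedSelberg.exists_mellinIntegrand_eq {a : ℕ → ℂ} {F : ℂ → ℂ}
    (hF : IsExtendedSelberg 1 a F) (ha0 : a 0 = 0) :
    ∃ (θ ρ T : ℝ) (h : ℝ → ℂ) (C ω : ℂ), 1 ≤ T ∧ C ≠ 0 ∧ ω ≠ 0 ∧ ContinuousOn h (Ioi T) ∧
      Tendsto h atTop (𝓝 C) ∧ (∃ B : ℝ, ∀ t, T < t → ‖h t‖ ≤ B) ∧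
      ∀ c : ℝ, 0 < c → ∀ u : ℝ, ∀ t : ℝ, T < t →
        mellinIntegrand F (c * (u + I)) (-1 + I * t) =
          ω * (c * (u + I)) * ∑' n : ℕ, conj (LSeries.term a 2 n) *
            laplaceIntegrand h θ (Real.log n - Real.log c - ρ)
              (I * Complex.log (u + I) + Real.pi / 2) t := by
  obtain ⟨g, ω, hω, hg, hfe⟩ := hF.functional_equation
  obtain ⟨θ, ρ, C, hC, hlim⟩ := g.hasStirlingForm_kernel hg
  obtain ⟨K, hK, hne⟩ := g.eventually_norm_eval_le hg
  set h : ℝ → ℂ := fun t =>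
    Complex.Gamma (-1 + I * t) * (conj (g.eval (2 + I * t)) / g.eval (-1 + I * t)) *
      Complex.exp (-(0 * (t * Real.log t) + I * θ * Real.log t + (-(Real.pi / 2) - I * ρ) * t))
    with hh
  have hbd : ∀ᶠ t in atTop, ‖h t‖ ≤ ‖C‖ + 1 := hlim.norm.eventually_le_const (lt_add_one _)
  obtain ⟨T, hT⟩ := eventually_atTop.1 (((hne.and hbd).and (g.eventually_regularAt (-1))).and
    ((g.eventually_regularAt 2).and hfe.eventually))
  have hω0 : ω ≠ 0 := norm_pos_iff.1 (by rw [hω]; exact one_pos)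
  refine ⟨θ, ρ, max T 1, h, C, ω, le_max_right _ _, hC, hω0, ?_, hlim, ⟨‖C‖ + 1, fun t ht =>
    (hT t ((le_max_left _ _).trans ht.le)).1.1.2⟩, fun c hc u t ht => ?_⟩
  · intro t ht
    have htT : T ≤ t := (le_max_left _ _).trans (le_of_lt ht)
    have ht1 : 1 < t := lt_of_le_of_lt (le_max_right _ _) ht
    obtain ⟨⟨⟨⟨hn, -⟩, -⟩, hr1⟩, hr2, -⟩ := hT t htT
    refine ContinuousAt.continuousWithinAt ?_
    have hl : ContinuousAt (fun t : ℝ => (Real.log t : ℂ)) t :=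
      Complex.continuous_ofReal.continuousAt.comp (Real.continuousAt_log (by linarith))
    refine ContinuousAt.mul (ContinuousAt.mul ?_ (ContinuousAt.div ?_ ?_ hn)) ?_
    · refine ContinuousAt.comp (f := fun t : ℝ => (-1 : ℂ) + I * t)
        (continuousAt_Gamma_of_im_ne_zero ?_) (by fun_prop)
      simp; linarith
    · refine Complex.continuous_conj.continuousAt.comp ?_
      exact ContinuousAt.comp (f := fun t : ℝ => (2 : ℂ) + I * t)
        (g.continuousAt_eval (by simpa using hr2)) (by fun_prop)
    · exact ContinuousAt.comp (f := fun t : ℝ => (-1 : ℂ) + I * t)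
        (g.continuousAt_eval (by simpa using hr1)) (by fun_prop)
    · refine ContinuousAt.cexp (ContinuousAt.neg ?_)
      exact (((by fun_prop : ContinuousAt (fun t : ℝ => (t : ℂ)) t).mul hl).const_mul _ |>.add
        (hl.const_mul _)).add (by fun_prop)
  · have htT : T ≤ t := (le_max_left _ _).trans (le_of_lt ht)
    obtain ⟨⟨⟨⟨hn, -⟩, -⟩, -⟩, -, hfe'⟩ := hT t htT
    have hF1 : F (-1 + I * t) =
        ω * (conj (g.eval (2 + I * t)) / g.eval (-1 + I * t)) * conj (F (2 + I * t)) := by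
      rw [map_mul] at hfe'
      field_simp
      linear_combination hfe'
    have hF2 : conj (F (2 + I * t)) =
        ∑' n : ℕ, conj (LSeries.term a 2 n) * Complex.exp (I * t * Real.log n) := by
      rw [hF.eq_LSeries _ (by simp), LSeries, Complex.conj_tsum]
      refine tsum_congr fun n => ?_
      rw [LSeries_term_eq_mul_exp ha0, LSeries_term_eq_mul_exp ha0, map_mul, map_mul,
        ← Complex.exp_conj, ← Complex.exp_conj, mul_assoc, ← Complex.exp_add]
      congr 2
      simp only [map_neg, map_add, map_mul, Complex.conj_I, Complex.conj_ofReal,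
        Complex.conj_ofNat]
      ring
    have hcu : (c : ℂ) * (u + I) ≠ 0 := by
      refine mul_ne_zero (by exact_mod_cast hc.ne') fun h => ?_
      simpa using congrArg im h
    rw [mellinIntegrand, hF1, hF2]
    rw [show -(-1 + I * (t : ℂ)) * Complex.log (c * (u + I)) = Complex.log (c * (u + I)) +
      -(I * t) * Complex.log (c * (u + I)) by ring, Complex.exp_add, Complex.exp_log hcu,
      log_mul_add_I hc]
    rw [← tsum_mul_left, ← tsum_mul_left, ← tsum_mul_left, ← tsum_mul_right]
    refine tsum_congr fun n => ?_
    rw [laplaceIntegrand, hh]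
    have key : Complex.exp (-(0 * (t * Real.log t) + I * θ * Real.log t +
        (-(Real.pi / 2) - I * ρ) * t)) * Complex.exp (I * θ * Real.log t +
          I * ((Real.log n - Real.log c - ρ : ℝ) : ℂ) * t -
            (I * Complex.log (u + I) + Real.pi / 2) * t) =
        Complex.exp (I * t * Real.log n) *
          Complex.exp (-(I * t) * (Real.log c + Complex.log (u + I))) := by
      rw [← Complex.exp_add, ← Complex.exp_add]
      congr 1
      push_cast
      ring
    simp only
    linear_combination (-(ω * (c * (u + I)) * conj (LSeries.term a 2 n) *
      (Complex.Gamma (-1 + I * t) * (conj (g.eval (2 + I * t)) / g.eval (-1 + I * t))))) * key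

open Asymptotics in
/-- The parts of the Mellin integral which are not shifted to the line `Re w = -1` stay bounded as
`z` approaches a point of the positive imaginary axis. -/
lemma IsExtendedSelberg.exists_bound_integral {d : ℝ} {a : ℕ → ℂ} {F : ℂ → ℂ}
    (hF : IsExtendedSelberg d a F) {T c : ℝ} (hT : 0 < T) (hc : 0 < c) :
    ∃ M : ℝ, ∀ᶠ u : ℝ in 𝓝[>] 0,
      ‖(∫ t in Iic T, mellinIntegrand F (c * (u + I)) (2 + I * t)) +
        I * ∫ x in (-1 : ℝ)..2, mellinIntegrand F (c * (u + I)) (x + I * T)‖ ≤ M := by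
  have hsum2 : LSeriesSummable a 2 := hF.summable 2 (by simp)
  set M₀ := ∑' n, ‖LSeries.term a 2 n‖ with hM₀
  have hM₀0 : 0 ≤ M₀ := tsum_nonneg fun _ => norm_nonneg _
  have hΓ : Integrable fun t : ℝ => Complex.Gamma (2 + I * t) := by
    simpa using integrable_Gamma_two_add_mul_exp (z := 1) (by simp)
  set L : ℝ := ‖Complex.log (c * ((0 : ℝ) + I))‖ + 1 with hL
  have hlog : ∀ᶠ u : ℝ in 𝓝[>] 0, ‖Complex.log (c * (u + I))‖ ≤ L := by
    have h1 : ContinuousAt (fun u : ℝ => Complex.log (c * (u + I))) 0 := by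
      refine ContinuousAt.clog (by fun_prop) (Or.inr ?_)
      simpa using hc.ne'
    exact (h1.norm.tendsto.mono_left nhdsWithin_le_nhds).eventually_le_const (lt_add_one _)
  have hL0 : 0 ≤ L := by positivity
  obtain ⟨B, hB⟩ := (isCompact_Icc (a := (-1 : ℝ)) (b := 2)).exists_bound_of_continuousOn
    (f := fun x : ℝ => Complex.Gamma (x + I * T) * F (x + I * T)) (by
      intro x _
      refine ContinuousAt.continuousWithinAt (ContinuousAt.mul ?_ ?_)
      · exact ContinuousAt.comp (f := fun x : ℝ => (x : ℂ) + I * T)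
          (continuousAt_Gamma_of_im_ne_zero (by simpa using hT.ne')) (by fun_prop)
      · refine ContinuousAt.comp (f := fun x : ℝ => (x : ℂ) + I * T)
          (hF.differentiableAt fun h => ?_).continuousAt (by fun_prop)
        have := congrArg im h
        simp at this
        exact hT.ne' this)
  have hB0 : 0 ≤ B := (norm_nonneg _).trans (hB 0 (by norm_num))
  refine ⟨(∫ t : ℝ in Iic T, ‖Complex.Gamma (2 + I * t)‖ * M₀ * Real.exp ((2 + T) * L)) +
    B * Real.exp ((2 + T) * L) * |2 - (-1)|, ?_⟩
  filter_upwards [hlog, self_mem_nhdsWithin] with u hu hu0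
  have hu0' : (0 : ℝ) < u := hu0
  set z : ℂ := c * (u + I) with hz
  have him : 0 ≤ (Complex.log z).im := by
    rw [Complex.log_im, Complex.arg_nonneg_iff]
    simp [hz, hc.le]
  have hre' := abs_le.1 ((Complex.abs_re_le_norm (Complex.log z)).trans hu)
  have him' := (le_abs_self _).trans ((Complex.abs_im_le_norm (Complex.log z)).trans hu)
  refine (norm_add_le _ _).trans (add_le_add ?_ ?_)
  · refine norm_integral_le_of_norm_le
      ((hΓ.norm.mul_const M₀).mul_const _).integrableOn ?_
    refine (ae_restrict_iff' measurableSet_Iic).2 (Eventually.of_forall fun t ht => ?_)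
    have ht' : t ≤ T := ht
    rw [mellinIntegrand, norm_mul, norm_mul, Complex.norm_exp]
    have h1 : ‖F (2 + I * t)‖ ≤ M₀ := by
      rw [hF.eq_LSeries _ (by simp)]
      exact LSeries_norm_le hsum2 (by simp)
    gcongr
    have e : (-(2 + I * (t : ℂ)) * Complex.log z).re =
        -2 * (Complex.log z).re + t * (Complex.log z).im := by
      simp
    rw [e]
    nlinarith [mul_le_mul_of_nonneg_right ht' him]
  · rw [norm_mul, Complex.norm_I, one_mul]
    refine intervalIntegral.norm_integral_le_of_norm_le_const fun x hx => ?_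
    rw [uIoc_of_le (by norm_num)] at hx
    rw [mellinIntegrand, norm_mul, Complex.norm_exp]
    have h1 := hB x ⟨hx.1.le, hx.2⟩
    gcongr
    have e : (-((x : ℂ) + I * T) * Complex.log z).re =
        -x * (Complex.log z).re + T * (Complex.log z).im := by
      simp
    rw [e]
    have : -x * (Complex.log z).re ≤ 2 * L := by
      refine (le_abs_self _).trans ?_
      rw [abs_mul, abs_neg]
      exact mul_le_mul (abs_le.2 ⟨by linarith [hx.1], hx.2⟩) (abs_le.2 hre') (abs_nonneg _)
        (by norm_num)
    nlinarith

/-- The asymptotic behaviour of `∑ a(n) exp (-n z)` as `z` tends to the point `i c` of the positive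
imaginary axis along `z = c (u + i)`, `u → 0+`, normalised by `u ^ (1 + iθ)`. The limit is a series
with at most one nonzero term. -/
theorem IsExtendedSelberg.tendsto_tsum_exp {a : ℕ → ℂ} {F : ℂ → ℂ}
    (hF : IsExtendedSelberg 1 a F) (ha0 : a 0 = 0) :
    ∃ (θ ρ : ℝ) (K : ℂ), K ≠ 0 ∧ ∀ c : ℝ, 0 < c →
      Tendsto (fun u : ℝ => u * Complex.exp (I * θ * Real.log u) *
        ∑' n : ℕ, a n * Complex.exp (-(c * (u + I) * n))) (𝓝[>] 0)
        (𝓝 (K * c * ∑' n : ℕ, conj (LSeries.term a 2 n) *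
          if Real.log n - Real.log c - ρ = 0 then 1 else 0)) := by
  obtain ⟨θ, ρ, T, h, C, ω, hT, hC, hω, hcont, hlim, ⟨B, hB⟩, hform⟩ :=
    hF.exists_mellinIntegrand_eq ha0
  have hsum2 : LSeriesSummable a 2 := hF.summable 2 (by simp)
  have hB0 : 0 ≤ B := (norm_nonneg _).trans (hB (T + 1) (by linarith))
  have hT0 : 0 ≤ T := by linarith
  have hpi : (Real.pi : ℂ) ≠ 0 := by exact_mod_cast Real.pi_ne_zero
  have hΓ : Complex.Gamma (1 + I * θ) ≠ 0 := by
    refine Complex.Gamma_ne_zero fun m hm => ?_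
    have := congrArg re hm
    simp at this
    have hm : (0 : ℝ) ≤ m := m.cast_nonneg
    linarith
  refine ⟨θ, ρ, 1 / (2 * Real.pi) * ω * I * (C * Complex.Gamma (1 + I * θ)),
    by simp [hpi, hω, hC, hΓ], fun c hc => ?_⟩
  have hphase := norm_exp_I_mul_log θ
  set ν : ℝ → ℂ := fun u => I * Complex.log (u + I) + Real.pi / 2 with hν
  have hνlim : Tendsto (fun u => ν u / u) (𝓝[>] 0) (𝓝 1) := tendsto_log_add_I_div
  have hre := eventually_half_lt_re hνlim
  set x : ℕ → ℝ := fun n => Real.log n - Real.log c - ρ with hx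
  set J : ℝ → ℕ → ℂ := fun u n => ∫ t in Ioi T, laplaceIntegrand h θ (x n) (ν u) t with hJ
  -- the shifted part, as a series of Laplace integrals
  have hshift : ∀ u : ℝ, 0 < (ν u).re →
      ∫ t in Ioi T, mellinIntegrand F (c * (u + I)) (-1 + I * t) =
        ω * (c * (u + I)) * ∑' n : ℕ, conj (LSeries.term a 2 n) * J u n := by
    intro u hu
    have h1 : ∀ n, Integrable (fun t => conj (LSeries.term a 2 n) *
        laplaceIntegrand h θ (x n) (ν u) t) (volume.restrict (Ioi T)) := fun n =>
      (integrableOn_laplaceIntegrand hT0 hcont hB θ (x n) hu).const_mul _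
    have h2 : Summable fun n => ∫ t in Ioi T, ‖conj (LSeries.term a 2 n) *
        laplaceIntegrand h θ (x n) (ν u) t‖ := by
      refine Summable.of_nonneg_of_le (fun n => integral_nonneg fun _ => norm_nonneg _)
        (fun n => ?_) (hsum2.norm.mul_right (B / (ν u).re))
      simp only [norm_mul, Complex.norm_conj, integral_const_mul]
      gcongr
      exact integral_norm_laplaceIntegrand_le hT0 hcont hB θ (x n) hu
    have h3 := (hasSum_integral_of_summable_integral_norm h1 h2).tsum_eq
    simp only [integral_const_mul] at h3
    rw [h3, ← integral_const_mul]
    refine setIntegral_congr_fun measurableSet_Ioi fun t ht => ?_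
    exact hform c hc u t ht
  -- the series of Laplace integrals, by dominated convergence for series
  have hser : Tendsto (fun u : ℝ => ∑' n : ℕ, conj (LSeries.term a 2 n) *
      (u * Complex.exp (I * θ * Real.log u) * J u n)) (𝓝[>] 0)
      (𝓝 (∑' n : ℕ, conj (LSeries.term a 2 n) *
        if x n = 0 then C * Complex.Gamma (1 + I * θ) else 0)) := by
    refine tendsto_tsum_of_dominated_convergence (bound := fun n => ‖LSeries.term a 2 n‖ * (2 * B))
      (hsum2.norm.mul_right _) (fun n => ?_) ?_
    · exact (tendsto_integral_laplaceIntegrand hT0 hcont hB hlim hνlim θ (x n)).const_mul _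
    · filter_upwards [hre, self_mem_nhdsWithin] with u hu hu0 n
      have hu0' : (0 : ℝ) < u := hu0
      have hνre : 0 < (ν u).re := by linarith
      rw [norm_mul, Complex.norm_conj, norm_mul, norm_mul, hphase, mul_one, Complex.norm_real,
        Real.norm_of_nonneg hu0'.le]
      refine mul_le_mul_of_nonneg_left ?_ (norm_nonneg _)
      have h4 : ‖J u n‖ ≤ B / (ν u).re := (norm_integral_le_integral_norm _).trans
        (integral_norm_laplaceIntegrand_le hT0 hcont hB θ (x n) hνre)
      calc u * ‖J u n‖ ≤ u * (B / (u / 2)) := by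
            refine mul_le_mul_of_nonneg_left (h4.trans ?_) hu0'.le
            exact div_le_div_of_nonneg_left hB0 (half_pos hu0') hu.le
        _ = 2 * B := by field_simp
  have hofReal : Tendsto (fun u : ℝ => (u : ℂ)) (𝓝[>] 0) (𝓝 0) :=
    (Complex.continuous_ofReal.tendsto' 0 0 (by simp)).mono_left nhdsWithin_le_nhds
  obtain ⟨M, hM⟩ := hF.exists_bound_integral (T := T) (by linarith) hc
  have hrest : Tendsto (fun u : ℝ => u * Complex.exp (I * θ * Real.log u) *
      ((∫ t in Iic T, mellinIntegrand F (c * (u + I)) (2 + I * t)) +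
        I * ∫ x in (-1 : ℝ)..2, mellinIntegrand F (c * (u + I)) (x + I * T))) (𝓝[>] 0) (𝓝 0) := by
    have h1 : Tendsto (fun u : ℝ => ‖(u : ℂ)‖ * M) (𝓝[>] 0) (𝓝 0) := by
      simpa using hofReal.norm.mul_const M
    refine squeeze_zero_norm' ?_ h1
    filter_upwards [hM] with u hu
    rw [norm_mul, norm_mul, hphase, mul_one]
    gcongr
  have hmain := (((hofReal.add_const I).const_mul (c : ℂ)).const_mul ω).mul hser
  have htot := (hrest.add hmain).const_mul (1 / (2 * Real.pi) : ℂ)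
  have hval : (1 / (2 * Real.pi) : ℂ) * (0 + ω * (c * (0 + I)) * ∑' n : ℕ,
      conj (LSeries.term a 2 n) * (if x n = 0 then C * Complex.Gamma (1 + I * θ) else 0)) =
      1 / (2 * Real.pi) * ω * I * (C * Complex.Gamma (1 + I * θ)) * c *
        ∑' n : ℕ, conj (LSeries.term a 2 n) * (if x n = 0 then 1 else 0) := by
    have : ∀ n, conj (LSeries.term a 2 n) *
        (if x n = 0 then C * Complex.Gamma (1 + I * θ) else 0) =
        (C * Complex.Gamma (1 + I * θ)) *
          (conj (LSeries.term a 2 n) * (if x n = 0 then 1 else 0)) := fun n => by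
      split_ifs <;> ring
    simp only [this, tsum_mul_left]
    ring
  rw [hval] at htot
  refine htot.congr' ?_
  filter_upwards [hre, self_mem_nhdsWithin] with u hu hu0
  have hu0' : (0 : ℝ) < u := hu0
  have hzre : 0 < ((c : ℂ) * (u + I)).re := by simpa using mul_pos hc hu0'
  obtain ⟨hint, heq⟩ := hF.tsum_exp_eq_integral ha0 hzre
  rw [heq, ← intervalIntegral.integral_Iic_add_Ioi hint.integrableOn hint.integrableOn (b := T),
    hF.integral_Ioi_mellinIntegrand hzre hT, hshift u (by linarith)]
  have : ∀ n, conj (LSeries.term a 2 n) * (u * Complex.exp (I * θ * Real.log u) * J u n) =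
      (u * Complex.exp (I * θ * Real.log u)) * (conj (LSeries.term a 2 n) * J u n) :=
    fun n => by ring
  simp only [this, tsum_mul_left]
  ring

end

/-! ### Periodicity of the coefficients -/

section

open MeasureTheory Set Filter Topology

/-- The limit of `∑ a(n) exp (-n z)` at the point `i c`, suitably normalised, depends only on `c`
modulo `2π`, because the series does. -/
lemma IsExtendedSelberg.exists_periodic_limit {a : ℕ → ℂ} {F : ℂ → ℂ}
    (hF : IsExtendedSelberg 1 a F) (ha0 : a 0 = 0) :
    ∃ θ ρ : ℝ, ∀ c c' : ℝ, 0 < c → c' = c + 2 * Real.pi →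
      ((c' : ℂ) ^ 2 * Complex.exp (I * θ * Real.log c') * ∑' n : ℕ, conj (LSeries.term a 2 n) *
          if Real.log n - Real.log c' - ρ = 0 then 1 else 0) =
        (c : ℂ) ^ 2 * Complex.exp (I * θ * Real.log c) * ∑' n : ℕ, conj (LSeries.term a 2 n) *
          if Real.log n - Real.log c - ρ = 0 then 1 else 0 := by
  obtain ⟨θ, ρ, K, hK, hlim⟩ := hF.tendsto_tsum_exp ha0
  refine ⟨θ, ρ, fun c c' hc hcc' => ?_⟩
  have hc' : 0 < c' := by rw [hcc']; positivity
  have h1 := hlim c hc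
  have h2 := hlim c' hc'
  set S := fun c : ℝ => ∑' n : ℕ, conj (LSeries.term a 2 n) *
    (if Real.log n - Real.log c - ρ = 0 then (1 : ℂ) else 0) with hS
  have hcc : (c : ℂ) ≠ 0 := by exact_mod_cast hc.ne'
  have hcc'0 : (c' : ℂ) ≠ 0 := by exact_mod_cast hc'.ne'
  have hsub : Tendsto (fun u : ℝ => c / c' * u) (𝓝[>] 0) (𝓝[>] 0) := by
    refine tendsto_nhdsWithin_of_tendsto_nhds_of_eventually_within _ ?_ ?_
    · exact ((continuous_const.mul continuous_id).tendsto' 0 0 (by simp)).mono_left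
        nhdsWithin_le_nhds
    · filter_upwards [self_mem_nhdsWithin] with u hu
      exact mul_pos (div_pos hc hc') hu
  have h3 := h1.const_mul ((c : ℂ) / c' * Complex.exp (I * θ * (Real.log c - Real.log c')))
  have huniq := tendsto_nhds_unique ((h2.comp hsub).congr' ?_) h3
  · change K * c' * S c' = _ * (K * c * S c) at huniq
    change (c' : ℂ) ^ 2 * _ * S c' = (c : ℂ) ^ 2 * _ * S c
    rw [mul_sub, Complex.exp_sub] at huniq
    have e1 := Complex.exp_ne_zero (I * θ * Real.log c')
    field_simp at huniq
    linear_combination huniq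
  · filter_upwards [self_mem_nhdsWithin] with u hu
    have hu' : (0 : ℝ) < u := hu
    have e1 : ∀ n : ℕ, Complex.exp (-((c' : ℂ) * (((c / c' * u : ℝ) : ℂ) + I) * n)) =
        Complex.exp (-((c : ℂ) * (u + I) * n)) := fun n => by
      have : -((c' : ℂ) * (((c / c' * u : ℝ) : ℂ) + I) * n) =
          -((c : ℂ) * (u + I) * n) - n * (2 * Real.pi * I) := by
        rw [hcc'] at hcc'0 ⊢
        push_cast at hcc'0 ⊢
        field_simp
        ring
      rw [this, Complex.exp_sub, Complex.exp_nat_mul_two_pi_mul_I, div_one]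
    simp only [Function.comp_def, e1]
    rw [Real.log_mul (div_pos hc hc').ne' hu'.ne', Real.log_div hc.ne' hc'.ne']
    push_cast
    rw [mul_add (I * (θ : ℂ)), Complex.exp_add]
    ring

lemma IsExtendedSelberg.exists_coeff_ne_zero {d : ℝ} {a : ℕ → ℂ} {F : ℂ → ℂ}
    (hF : IsExtendedSelberg d a F) : ∃ n : ℕ, n ≠ 0 ∧ a n ≠ 0 := by
  by_contra! hcon
  obtain ⟨s, hs, hne⟩ := hF.ne_zero
  refine hne ?_
  rw [hF.eq_LSeries s hs, LSeries_congr (g := 0) (fun {n} hn => hcon n hn) s]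
  simp

/-- The coefficients of an element of degree `1` are periodic up to a twist by `n ^ (iθ)`. -/
theorem IsExtendedSelberg.exists_periodic {a : ℕ → ℂ} {F : ℂ → ℂ}
    (hF : IsExtendedSelberg 1 a F) :
    ∃ (θ : ℝ) (N : ℕ), 0 < N ∧ ∀ n : ℕ, n ≠ 0 →
      a (n + N) * Complex.exp (-(I * θ) * Real.log (n + N : ℕ)) =
        a n * Complex.exp (-(I * θ) * Real.log n) := by
  -- the value `a 0` does not enter the Dirichlet series
  wlog ha0 : a 0 = 0 generalizing a
  · set b : ℕ → ℂ := Function.update a 0 0 with hb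
    have hab : ∀ n : ℕ, n ≠ 0 → b n = a n := fun n hn => Function.update_of_ne hn _ _
    have hLS : ∀ s, LSeries b s = LSeries a s := fun s => LSeries_congr (fun {n} hn => hab n hn) s
    have hFb : IsExtendedSelberg 1 b F :=
      ⟨fun s hs => (LSeriesSummable_congr s fun {n} hn => hab n hn).2 (hF.summable s hs),
        fun s hs => by rw [hLS, hF.eq_LSeries s hs], hF.ne_zero, hF.continuation,
        hF.functional_equation⟩
    obtain ⟨θ, N, hN, h⟩ := this hFb (by simp [hb])
    refine ⟨θ, N, hN, fun n hn => ?_⟩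
    have := h n hn
    rwa [hab n hn, hab (n + N) (by omega)] at this
  obtain ⟨θ, ρ, hper⟩ := hF.exists_periodic_limit ha0
  set r : ℝ := Real.exp ρ with hr
  have hr0 : 0 < r := Real.exp_pos ρ
  have hrc : (r : ℂ) ≠ 0 := by exact_mod_cast hr0.ne'
  have hlogr : Real.log r = ρ := Real.log_exp ρ
  set W := fun c : ℝ => (c : ℂ) ^ 2 * Complex.exp (I * θ * Real.log c) *
    ∑' n : ℕ, conj (LSeries.term a 2 n) *
      (if Real.log n - Real.log c - ρ = 0 then (1 : ℂ) else 0) with hW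
  have hcond : ∀ c : ℝ, 0 < c → ∀ n : ℕ, n ≠ 0 →
      (Real.log n - Real.log c - ρ = 0 ↔ (n : ℝ) = c * r) := by
    intro c hc n hn
    have hn' : (0 : ℝ) < n := by exact_mod_cast Nat.pos_of_ne_zero hn
    rw [← hlogr, sub_sub, sub_eq_zero, ← Real.log_mul hc.ne' hr0.ne']
    exact Real.log_injOn_pos.eq_iff hn' (mul_pos hc hr0)
  -- the value of the limit at the point `n / r`
  have hW1 : ∀ n : ℕ, n ≠ 0 → W (n / r) =
      ((r : ℂ) ^ 2)⁻¹ * Complex.exp (-(I * θ * Real.log r)) *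
        (Complex.exp (I * θ * Real.log n) * conj (a n)) := by
    intro n hn
    have hn' : (0 : ℝ) < n := by exact_mod_cast Nat.pos_of_ne_zero hn
    have hnc : (n : ℂ) ≠ 0 := by exact_mod_cast hn
    have hsum : ∑' m : ℕ, conj (LSeries.term a 2 m) *
        (if Real.log m - Real.log (n / r) - ρ = 0 then (1 : ℂ) else 0) =
        conj (a n) / (n : ℂ) ^ 2 := by
      rw [tsum_eq_single n]
      · rw [if_pos ((hcond _ (div_pos hn' hr0) n hn).2 (by field_simp)), mul_one,
          LSeries.term_of_ne_zero hn, map_div₀]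
        norm_cast
        rw [map_natCast]
      · intro m hm
        rcases eq_or_ne m 0 with rfl | hm0
        · simp
        · rw [if_neg, mul_zero]
          rw [hcond _ (div_pos hn' hr0) m hm0, div_mul_cancel₀ _ hr0.ne']
          exact_mod_cast hm
    simp only [hW]
    rw [hsum, Real.log_div hn'.ne' hr0.ne']
    push_cast
    rw [mul_sub, Complex.exp_sub, Complex.exp_neg]
    field_simp
  -- the limit vanishes at all other points
  have hW0 : ∀ c : ℝ, 0 < c → (∀ n : ℕ, n ≠ 0 → (n : ℝ) ≠ c * r) → W c = 0 := by
    intro c hc h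
    simp only [hW]
    rw [mul_eq_zero]
    right
    refine (tsum_congr fun n => ?_).trans tsum_zero
    rcases eq_or_ne n 0 with rfl | hn
    · simp
    · rw [if_neg (fun h' => h n hn ((hcond c hc n hn).1 h')), mul_zero]
  obtain ⟨n₀, hn₀, han₀⟩ := hF.exists_coeff_ne_zero
  have hcoef : ((r : ℂ) ^ 2)⁻¹ * Complex.exp (-(I * θ * Real.log r)) ≠ 0 :=
    mul_ne_zero (inv_ne_zero (pow_ne_zero _ hrc)) (Complex.exp_ne_zero _)
  -- the limit is nonzero at `n₀ / r`, hence also at `n₀ / r + 2π`: so `2πr` is an integer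
  obtain ⟨N, hN⟩ : ∃ N : ℕ, (N : ℝ) = 2 * Real.pi * r := by
    have hc0 : 0 < (n₀ : ℝ) / r :=
      div_pos (by exact_mod_cast Nat.pos_of_ne_zero hn₀) hr0
    have h1 : W (n₀ / r + 2 * Real.pi) ≠ 0 := by
      have : W (n₀ / r + 2 * Real.pi) = W (n₀ / r) := hper _ _ hc0 rfl
      rw [this, hW1 n₀ hn₀]
      refine mul_ne_zero hcoef (mul_ne_zero (Complex.exp_ne_zero _) ?_)
      simpa using han₀
    by_contra! hcon
    refine h1 (hW0 _ (by positivity) fun n hn h => ?_)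
    rw [add_mul, div_mul_cancel₀ _ hr0.ne'] at h
    have hpos : 0 < 2 * Real.pi * r := by positivity
    have hle : n₀ ≤ n := by
      have : (n₀ : ℝ) ≤ n := by linarith
      exact_mod_cast this
    refine hcon (n - n₀) ?_
    rw [Nat.cast_sub hle]
    linarith
  have hN0 : 0 < N := by
    have : (0 : ℝ) < N := by rw [hN]; positivity
    exact_mod_cast this
  refine ⟨θ, N, hN0, fun n hn => ?_⟩
  have hn' : (0 : ℝ) < n := by exact_mod_cast Nat.pos_of_ne_zero hn
  have h1 : W (((n + N : ℕ) : ℝ) / r) = W (n / r) := by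
    refine hper _ _ (div_pos hn' hr0) ?_
    push_cast
    rw [hN]
    field_simp
  rw [hW1 n hn, hW1 (n + N) (by omega)] at h1
  have h2 := congrArg conj (mul_left_cancel₀ hcoef h1)
  simp only [map_mul, Complex.conj_conj, ← Complex.exp_conj, Complex.conj_I,
    Complex.conj_ofReal] at h2
  rw [neg_mul] at h2
  rw [mul_comm, h2, mul_comm]

end

/-! ### Zeros of perturbed exponentials -/

section

open Set Filter Topology Metric

lemma HasExactlyOneZeroInside.mul_of_ne_zero {f U G : ℂ → ℂ} {c : ℂ} {R : ℝ}
    (hf : HasExactlyOneZeroInside f c R) (hU : AnalyticOnNhd ℂ U (ball c R))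
    (hU0 : ∀ s ∈ ball c R, U s ≠ 0) (hG : ∀ s ∈ ball c R, G s = U s * f s) :
    HasExactlyOneZeroInside G c R := by
  obtain ⟨hfa, z, hz, hord, huniq⟩ := hf
  have hev : ∀ s ∈ ball c R, G =ᶠ[𝓝 s] U * f := fun s hs => by
    filter_upwards [isOpen_ball.mem_nhds hs] with w hw using hG w hw
  refine ⟨fun s hs => ((hU s hs).mul (hfa s hs)).congr (hev s hs).symm, z, hz, ?_, ?_⟩
  · rw [analyticOrderAt_congr (hev z hz), analyticOrderAt_mul (hU z hz) (hfa z hz), hord,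
      (hU z hz).analyticOrderAt_eq_zero.2 (hU0 z hz), zero_add]
  · intro w hw h0
    rw [hG w hw, mul_eq_zero] at h0
    exact huniq w hw (h0.resolve_left (hU0 w hw))

/-- A small perturbation of `exp (Λ (s - c)) - 1` has exactly one zero in a small disc around `c`.
Newton's map `s ↦ s - f(s) / Λ` is a contraction there, so it has a fixed point, and only one. -/
lemma exists_hasExactlyOneZeroInside_exp_sub_one_add {Λ : ℂ} (hΛ : Λ ≠ 0) :
    ∃ r κ : ℝ, 0 < r ∧ 0 < κ ∧ ∀ (c : ℂ) (E : ℂ → ℂ) (R e : ℝ),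
      DifferentiableOn ℂ E (ball c 1) → (∀ s ∈ ball c 1, ‖E s‖ ≤ e) → 0 < R → R ≤ r →
      e ≤ κ * R → HasExactlyOneZeroInside (fun s => Complex.exp (Λ * (s - c)) - 1 + E s) c R := by
  have hΛ0 : 0 < ‖Λ‖ := norm_pos_iff.2 hΛ
  refine ⟨min (1 / 2) (1 / (8 * ‖Λ‖)), ‖Λ‖ / 16, by positivity, by positivity,
    fun c E R e hE hEe hR hRr heR => ?_⟩
  set f : ℂ → ℂ := fun s => Complex.exp (Λ * (s - c)) - 1 + E s with hf
  have hR2 : R ≤ 1 / 2 := hRr.trans (min_le_left _ _)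
  have hRΛ : ‖Λ‖ * R ≤ 1 / 8 := by
    have := hRr.trans (min_le_right _ _)
    rw [le_div_iff₀ (by positivity)] at this
    linarith
  have he0 : 0 ≤ e := (norm_nonneg _).trans (hEe c (mem_ball_self one_pos))
  have hsub : ball c R ⊆ ball c 1 := ball_subset_ball (by linarith)
  have hEd : ∀ s ∈ ball c 1, DifferentiableAt ℂ E s := fun s hs =>
    hE.differentiableAt (isOpen_ball.mem_nhds hs)
  have hfd : ∀ s ∈ ball c 1, HasDerivAt f (Complex.exp (Λ * (s - c)) * Λ + deriv E s) s := by
    intro s hs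
    have h1 : HasDerivAt (fun s => Λ * (s - c)) Λ s := by
      simpa using ((hasDerivAt_id s).sub_const c).const_mul Λ
    exact (h1.cexp.sub_const 1).add (hEd s hs).hasDerivAt
  -- the derivative of `f` is close to `Λ`
  have hder : ∀ s ∈ ball c R, ‖Complex.exp (Λ * (s - c)) * Λ + deriv E s - Λ‖ ≤ ‖Λ‖ / 2 := by
    intro s hs
    have hs' : ‖s - c‖ < R := by simpa [dist_eq_norm] using hs
    have h1 : ‖Λ * (s - c)‖ ≤ 1 / 8 := by
      rw [norm_mul]
      exact (mul_le_mul_of_nonneg_left hs'.le hΛ0.le).trans hRΛ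
    have h2 : ‖Complex.exp (Λ * (s - c)) - 1‖ ≤ 1 / 4 := by
      have := Complex.norm_exp_sub_one_le (h1.trans (by norm_num))
      linarith
    have h3 : ‖deriv E s‖ ≤ e / (1 / 4) := by
      have hcl : closedBall s (1 / 4) ⊆ ball c 1 := by
        intro w hw
        rw [mem_ball, dist_eq_norm]
        rw [mem_closedBall, dist_eq_norm] at hw
        calc ‖w - c‖ = ‖(w - s) + (s - c)‖ := by ring_nf
          _ ≤ ‖w - s‖ + ‖s - c‖ := norm_add_le _ _
          _ < 1 := by linarith
      refine Complex.norm_deriv_le_of_forall_mem_sphere_norm_le (by norm_num)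
        ((hE.mono hcl).diffContOnCl_ball subset_rfl) fun w hw => ?_
      exact hEe w (hcl (sphere_subset_closedBall hw))
    have e1 : Complex.exp (Λ * (s - c)) * Λ + deriv E s - Λ =
        (Complex.exp (Λ * (s - c)) - 1) * Λ + deriv E s := by ring
    rw [e1]
    refine (norm_add_le _ _).trans ?_
    rw [norm_mul]
    have h4 : ‖Complex.exp (Λ * (s - c)) - 1‖ * ‖Λ‖ ≤ 1 / 4 * ‖Λ‖ := by gcongr
    have h5 : e ≤ ‖Λ‖ / 16 := by nlinarith
    rw [div_div_eq_mul_div, div_one] at h3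
    linarith
  set N : ℂ → ℂ := fun s => s - f s / Λ with hN
  have hlip : ∀ s ∈ ball c R, ∀ w ∈ ball c R, ‖N s - N w‖ ≤ 1 / 2 * ‖s - w‖ := by
    intro s hs w hw
    refine (convex_ball c R).norm_image_sub_le_of_norm_hasDerivWithin_le (𝕜 := ℂ)
      (f' := fun s => 1 - (Complex.exp (Λ * (s - c)) * Λ + deriv E s) / Λ)
      (fun v hv => (((hasDerivAt_id v).sub
        ((hfd v (hsub hv)).div_const Λ))).hasDerivWithinAt) (fun v hv => ?_) hw hs
    have : (1 : ℂ) - (Complex.exp (Λ * (v - c)) * Λ + deriv E v) / Λ =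
        -(Complex.exp (Λ * (v - c)) * Λ + deriv E v - Λ) / Λ := by
      field_simp; ring
    rw [this, norm_div, norm_neg, div_le_iff₀ hΛ0]
    linarith [hder v hv]
  have hNc : ‖N c - c‖ ≤ R / 16 := by
    have : N c - c = -(E c / Λ) := by simp [hN, hf]
    rw [this, norm_neg, norm_div, div_le_iff₀ hΛ0]
    have := hEe c (mem_ball_self one_pos)
    linarith
  have hhalf : closedBall c (R / 2) ⊆ ball c R := closedBall_subset_ball (by linarith)
  have hmaps : MapsTo N (closedBall c (R / 2)) (closedBall c (R / 2)) := by
    intro s hs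
    have h1 := hlip s (hhalf hs) c (mem_ball_self hR)
    rw [mem_closedBall, dist_eq_norm] at hs ⊢
    calc ‖N s - c‖ = ‖(N s - N c) + (N c - c)‖ := by ring_nf
      _ ≤ ‖N s - N c‖ + ‖N c - c‖ := norm_add_le _ _
      _ ≤ R / 2 := by linarith
  have hcontr : ContractingWith (1 / 2) (hmaps.restrict N _ _) := by
    refine ⟨by norm_num, LipschitzWith.of_dist_le_mul fun s w => ?_⟩
    have := hlip s (hhalf s.2) w (hhalf w.2)
    rw [Subtype.dist_eq, Subtype.dist_eq, dist_eq_norm, dist_eq_norm]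
    simpa using this
  obtain ⟨z, hz, hfix, -⟩ := hcontr.exists_fixedPoint' isClosed_closedBall.isComplete hmaps
    (mem_closedBall_self (by linarith : (0 : ℝ) ≤ R / 2)) (edist_ne_top _ _)
  have hzero : ∀ s, N s = s ↔ f s = 0 := fun s => by
    simp [hN, hΛ]
  have hfz : f z = 0 := (hzero z).1 hfix
  have hfa : AnalyticOnNhd ℂ f (ball c R) :=
    DifferentiableOn.analyticOnNhd (fun s hs =>
      (hfd s (hsub hs)).differentiableAt.differentiableWithinAt) isOpen_ball
  refine ⟨hfa, z, hhalf hz, ?_, fun w hw h0 => ?_⟩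
  · refine (hfa z (hhalf hz)).analyticOrderAt_eq_one_of_zero_deriv_ne_zero hfz ?_
    rw [(hfd z (hsub (hhalf hz))).deriv]
    intro h
    have := hder z (hhalf hz)
    rw [h, zero_sub, norm_neg] at this
    linarith
  · have h1 := hlip w hw z (hhalf hz)
    rw [(hzero w).2 h0, (hzero z).2 hfz] at h1
    have h2 : ‖w - z‖ = 0 := le_antisymm (by linarith) (norm_nonneg _)
    exact sub_eq_zero.1 (norm_eq_zero.1 h2)

/-! ### Combinations of Hurwitz zeta functions -/

/-- Exponential decay of `f w` as `Re w → ∞`: a bound `K ρ ^ Re w`, `ρ < 1`, on the half plane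
`Re w ≥ 2`, inside the region of absolute convergence of the Hurwitz zeta functions. -/
def IsExpSmall (f : ℂ → ℂ) : Prop :=
  ∃ ρ K : ℝ, 0 < ρ ∧ ρ < 1 ∧ 0 ≤ K ∧ ∀ w : ℂ, 2 ≤ w.re → ‖f w‖ ≤ K * ρ ^ w.re

lemma IsExpSmall.zero : IsExpSmall fun _ => 0 :=
  ⟨1 / 2, 0, by norm_num, by norm_num, le_rfl, by simp⟩

lemma IsExpSmall.common {f g : ℂ → ℂ} (hf : IsExpSmall f) (hg : IsExpSmall g) :
    ∃ ρ K : ℝ, 0 < ρ ∧ ρ < 1 ∧ 0 ≤ K ∧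
      ∀ w : ℂ, 2 ≤ w.re → ‖f w‖ ≤ K * ρ ^ w.re ∧ ‖g w‖ ≤ K * ρ ^ w.re := by
  obtain ⟨ρ, K, hρ, hρ1, hK, h⟩ := hf
  obtain ⟨ρ', K', hρ', hρ1', hK', h'⟩ := hg
  refine ⟨max ρ ρ', max K K', lt_max_of_lt_left hρ, max_lt hρ1 hρ1', le_max_of_le_left hK,
    fun w hw => ⟨(h w hw).trans ?_, (h' w hw).trans ?_⟩⟩
  · have : 0 ≤ w.re := by linarith
    gcongr
    · exact le_max_left _ _
    · exact le_max_left _ _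
  · have : 0 ≤ w.re := by linarith
    gcongr
    · exact le_max_right _ _
    · exact le_max_right _ _

lemma IsExpSmall.add {f g : ℂ → ℂ} (hf : IsExpSmall f) (hg : IsExpSmall g) :
    IsExpSmall fun w => f w + g w := by
  obtain ⟨ρ, K, hρ, hρ1, hK, h⟩ := hf.common hg
  refine ⟨ρ, 2 * K, hρ, hρ1, by positivity, fun w hw => (norm_add_le _ _).trans ?_⟩
  linarith [(h w hw).1, (h w hw).2]

lemma IsExpSmall.const_mul {f : ℂ → ℂ} (hf : IsExpSmall f) (c : ℂ) :
    IsExpSmall fun w => c * f w := by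
  obtain ⟨ρ, K, hρ, hρ1, hK, h⟩ := hf
  refine ⟨ρ, ‖c‖ * K, hρ, hρ1, by positivity, fun w hw => ?_⟩
  rw [norm_mul, mul_assoc]
  gcongr
  exact h w hw

lemma IsExpSmall.sum {ι : Type*} (s : Finset ι) {f : ι → ℂ → ℂ} (h : ∀ i ∈ s, IsExpSmall (f i)) :
    IsExpSmall fun w => ∑ i ∈ s, f i w := by
  classical
  induction s using Finset.induction_on with
  | empty => simpa using IsExpSmall.zero
  | insert a s ha ih =>
    simp only [Finset.sum_insert ha]
    exact (h a (Finset.mem_insert_self a s)).add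
      (ih fun i hi => h i (Finset.mem_insert_of_mem hi))

lemma isExpSmall_exp_sub_log {x y : ℝ} (hx : 0 < x) (hxy : x < y) :
    IsExpSmall fun w => Complex.exp (w * (Real.log x - Real.log y)) := by
  have hy : 0 < y := hx.trans hxy
  refine ⟨x / y, 1, div_pos hx hy, (div_lt_one hy).2 hxy, zero_le_one, fun w _ => ?_⟩
  rw [← Complex.ofReal_sub, ← Real.log_div hx.ne' hy.ne', Complex.norm_exp, Complex.re_mul_ofReal,
    Real.rpow_def_of_pos (div_pos hx hy), one_mul, mul_comm]

/-- The Hurwitz zeta function is `y ^ (-w)` up to `O((1 + y) ^ (-Re w))`. -/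
lemma isExpSmall_hurwitzZeta_sub {x y : ℝ} (hx : 0 < x) (hy : 0 < y) (hy1 : y ≤ 1)
    (hxy : x < 1 + y) : IsExpSmall fun w =>
      (HurwitzZeta.hurwitzZeta y w - Complex.exp (-w * Real.log y)) *
        Complex.exp (w * Real.log x) := by
  have hy' : 0 < 1 + y := by linarith
  set K := ∑' m : ℕ, (((m : ℝ) + 1 + y) / (1 + y)) ^ (-2 : ℝ) with hK
  have hKs : Summable fun m : ℕ => (((m : ℝ) + 1 + y) / (1 + y)) ^ (-2 : ℝ) := by
    have h1 := (summable_nat_add_iff 1).2 (Real.summable_one_div_nat_pow.2 one_lt_two)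
    refine Summable.of_nonneg_of_le (fun m => by positivity) (fun m => ?_)
      (h1.mul_left ((1 + y) ^ 2))
    rw [Real.rpow_neg (by positivity), Real.rpow_two, div_pow, inv_div, mul_one_div]
    push_cast
    exact div_le_div_of_nonneg_left (by positivity) (by positivity)
      (pow_le_pow_left₀ (by positivity) (by linarith) 2)
  refine ⟨x / (1 + y), K, div_pos hx hy', (div_lt_one hy').2 hxy,
    tsum_nonneg fun m => by positivity, fun w hw => ?_⟩
  have hs := HurwitzZeta.hasSum_hurwitzZeta_of_one_lt_re ⟨hy.le, hy1⟩ (s := w) (by linarith)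
  have hs1 := (hasSum_nat_add_iff' 1).2 hs
  have hyc : (y : ℂ) ≠ 0 := by exact_mod_cast hy.ne'
  simp only [Finset.range_one, Finset.sum_singleton, Nat.cast_zero, zero_add] at hs1
  have e0 : 1 / (y : ℂ) ^ w = Complex.exp (-w * Real.log y) := by
    rw [Complex.cpow_def_of_ne_zero hyc, one_div, ← Complex.exp_neg, ← Complex.ofReal_log hy.le]
    congr 1; ring
  rw [e0] at hs1
  have hterm : ∀ m : ℕ, ‖1 / (((m + 1 : ℕ) : ℂ) + y) ^ w‖ ≤
      (1 + y) ^ (-w.re) * (((m : ℝ) + 1 + y) / (1 + y)) ^ (-2 : ℝ) := by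
    intro m
    have hpos : 0 < (m : ℝ) + 1 + y := by positivity
    have e1 : ((m + 1 : ℕ) : ℂ) + y = (((m : ℝ) + 1 + y : ℝ) : ℂ) := by push_cast; ring
    rw [e1, norm_div, norm_one, Complex.norm_cpow_eq_rpow_re_of_pos hpos, one_div,
      ← Real.rpow_neg hpos.le]
    calc ((m : ℝ) + 1 + y) ^ (-w.re) =
          ((1 + y) * (((m : ℝ) + 1 + y) / (1 + y))) ^ (-w.re) := by
          rw [mul_div_cancel₀ _ hy'.ne']
      _ = (1 + y) ^ (-w.re) * (((m : ℝ) + 1 + y) / (1 + y)) ^ (-w.re) :=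
          Real.mul_rpow hy'.le (by positivity)
      _ ≤ _ := by
          gcongr
          · rw [one_le_div hy']
            have : (0 : ℝ) ≤ m := m.cast_nonneg
            linarith
  have hbound : ‖HurwitzZeta.hurwitzZeta y w - Complex.exp (-w * Real.log y)‖ ≤
      (1 + y) ^ (-w.re) * K := by
    rw [← hs1.tsum_eq, hK, ← tsum_mul_left]
    exact tsum_of_norm_bounded (hKs.mul_left _).hasSum hterm
  rw [norm_mul, Complex.norm_exp, Complex.re_mul_ofReal, mul_comm w.re,
    ← Real.rpow_def_of_pos hx]
  calc _ ≤ ((1 + y) ^ (-w.re) * K) * x ^ w.re := by gcongr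
    _ = _ := by rw [Real.div_rpow hx.le hy'.le, Real.rpow_neg hy'.le]; ring

/-- A nonzero linear combination of Hurwitz zeta functions with distinct parameters in `(0, 1]` is
asymptotic to a multiple of `x ^ (-w)` as `Re w → ∞`, where `x` is the smallest parameter. -/
lemma exists_isExpSmall_sum_hurwitzZeta {ι : Type*} [Fintype ι] {y : ι → ℝ} {ψ : ι → ℂ}
    (hy : ∀ i, 0 < y i ∧ y i ≤ 1) (hinj : Function.Injective y) (hψ : ψ ≠ 0) :
    ∃ (x : ℝ) (C : ℂ), 0 < x ∧ C ≠ 0 ∧ IsExpSmall fun w =>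
      (∑ i, ψ i * HurwitzZeta.hurwitzZeta (y i) w) * Complex.exp (w * Real.log x) / C - 1 := by
  classical
  have hne : (Finset.univ.filter fun i => ψ i ≠ 0).Nonempty := by
    obtain ⟨i, hi⟩ := Function.ne_iff.1 hψ
    exact ⟨i, by simpa using hi⟩
  obtain ⟨i₀, hi₀, hmin⟩ := Finset.exists_min_image _ y hne
  have hC : ψ i₀ ≠ 0 := by simpa using hi₀
  set x := y i₀ with hx
  have hx0 : 0 < x := (hy i₀).1
  refine ⟨x, ψ i₀, hx0, hC, ?_⟩
  have hterm : ∀ i ∈ Finset.univ, IsExpSmall fun w =>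
      ψ i * HurwitzZeta.hurwitzZeta (y i) w * Complex.exp (w * Real.log x) -
        if i = i₀ then ψ i₀ else 0 := by
    intro i _
    have hxy : x < 1 + y i := by linarith [(hy i₀).2, (hy i).1]
    have h1 := (isExpSmall_hurwitzZeta_sub hx0 (hy i).1 (hy i).2 hxy).const_mul (ψ i)
    split_ifs with hi
    · subst hi
      convert! h1 using 2 with w
      have : Complex.exp (-w * Real.log x) * Complex.exp (w * Real.log x) = 1 := by
        rw [← Complex.exp_add, neg_mul, neg_add_cancel, Complex.exp_zero]
      linear_combination (ψ i) * this
    · rcases eq_or_ne (ψ i) 0 with h0 | h0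
      · simpa [h0] using IsExpSmall.zero
      · have hlt : x < y i := lt_of_le_of_ne (hmin i (by simpa using h0))
          fun h => hi (hinj h.symm)
        have h2 := h1.add ((isExpSmall_exp_sub_log hx0 hlt).const_mul (ψ i))
        convert! h2 using 2 with w
        have : Complex.exp (-w * Real.log (y i)) * Complex.exp (w * Real.log x) =
            Complex.exp (w * (Real.log x - Real.log (y i))) := by
          rw [← Complex.exp_add]; congr 1; ring
        linear_combination (ψ i) * this
  have hsum := (IsExpSmall.sum Finset.univ hterm).const_mul (ψ i₀)⁻¹
  convert! hsum using 2 with w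
  rw [Finset.sum_sub_distrib, Finset.sum_ite_eq' Finset.univ i₀, if_pos (Finset.mem_univ _),
    ← Finset.sum_mul]
  field_simp

end

/-! ### The twist and its zeros -/

section

open Set Filter Topology Metric

open HurwitzZeta in
lemma meromorphicAt_expZeta (a : UnitAddCircle) (s : ℂ) : MeromorphicAt (expZeta a) s := by
  have hdiff : ∀ w, w ≠ 1 → DifferentiableAt ℂ (expZeta a) w := fun w hw =>
    differentiableAt_expZeta a w (Or.inl hw)
  have hopen : IsOpen {w : ℂ | w ≠ 1} := isOpen_ne
  rcases ne_or_eq s 1 with hs | rfl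
  · exact (DifferentiableOn.analyticAt (fun w hw => (hdiff w hw).differentiableWithinAt)
      (hopen.mem_nhds hs)).meromorphicAt
  rcases ne_or_eq a 0 with ha | rfl
  · exact ((differentiable_expZeta_of_ne_zero ha).analyticAt 1).meromorphicAt
  -- for `a = 0` there is at most a simple pole: remove the singularity of `(s - 1) * expZeta 0 s`
  have hres : Tendsto (fun s => (s - 1) * expZeta 0 s) (𝓝[≠] 1) (𝓝 1) := by
    simpa only [expZeta_zero] using riemannZeta_residue_one
  set g : ℂ → ℂ := Function.update (fun s => (s - 1) * expZeta 0 s) 1 1 with hg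
  have hgan : AnalyticAt ℂ g 1 := by
    refine Complex.analyticAt_of_differentiable_on_punctured_nhds_of_continuousAt ?_
      (continuousAt_update_same.2 hres)
    filter_upwards [self_mem_nhdsWithin] with w hw
    have h1 : DifferentiableAt ℂ (fun s => (s - 1) * expZeta 0 s) w :=
      (by fun_prop : DifferentiableAt ℂ (fun s : ℂ => s - 1) w).mul (hdiff w hw)
    refine h1.congr_of_eventuallyEq ?_
    filter_upwards [hopen.mem_nhds hw] with v hv
    exact Function.update_of_ne hv _ _
  have hinv : MeromorphicAt (fun s : ℂ => (s - 1)⁻¹) 1 :=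
    ((by fun_prop : AnalyticAt ℂ (fun s : ℂ => s - 1) 1).meromorphicAt).inv
  refine (hinv.mul hgan.meromorphicAt).congr ?_
  filter_upwards [self_mem_nhdsWithin] with w hw
  have hw' : w - 1 ≠ 0 := sub_ne_zero.2 hw
  rw [Pi.mul_apply, hg, Function.update_of_ne hw, inv_mul_cancel_left₀ hw']

/-- Finite Fourier expansion of a sequence which is periodic on the positive integers. -/
lemma exists_fourier_of_periodic {c : ℕ → ℂ} {N : ℕ} [NeZero N]
    (hc : ∀ n : ℕ, n ≠ 0 → c (n + N) = c n) (hne : ∃ n : ℕ, n ≠ 0 ∧ c n ≠ 0) :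
    ∃ ψ : ZMod N → ℂ, ψ ≠ 0 ∧ ∀ n : ℕ, n ≠ 0 →
      c n = ∑ j, ψ j * ZMod.stdAddChar (j * (n : ZMod N)) := by
  have hc' : ∀ m n : ℕ, n ≠ 0 → c (n + N * m) = c n := by
    intro m
    induction m with
    | zero => simp
    | succ m ih =>
      intro n hn
      rw [mul_add, mul_one, ← add_assoc, hc _ (by omega), ih n hn]
  have hN : 0 < N := Nat.pos_of_ne_zero (NeZero.ne N)
  set φ : ZMod N → ℂ := fun k => c (k.val + N) with hφ
  have hφc : ∀ n : ℕ, n ≠ 0 → φ (n : ZMod N) = c n := by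
    intro n hn
    have h1 := hc' (n / N) (n % N + N) (by omega)
    have h2 : n % N + N + N * (n / N) = n + N := by
      have := Nat.mod_add_div n N
      omega
    rw [h2, hc n hn] at h1
    simp only [hφ, ZMod.val_natCast]
    exact h1.symm
  have hinv : ∀ k, φ k = (N : ℂ)⁻¹ • ∑ j : ZMod N, ZMod.stdAddChar (j * k) • ZMod.dft φ j := by
    intro k
    rw [← ZMod.invDFT_apply, LinearEquiv.symm_apply_apply]
  have hexp : ∀ n : ℕ, n ≠ 0 →
      c n = ∑ j, ((N : ℂ)⁻¹ * ZMod.dft φ j) * ZMod.stdAddChar (j * (n : ZMod N)) := by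
    intro n hn
    rw [← hφc n hn, hinv, smul_eq_mul, Finset.mul_sum]
    refine Finset.sum_congr rfl fun j _ => ?_
    rw [smul_eq_mul]
    ring
  refine ⟨fun j => (N : ℂ)⁻¹ * ZMod.dft φ j, fun h0 => ?_, hexp⟩
  obtain ⟨n, hn, hcn⟩ := hne
  refine hcn ?_
  rw [hexp n hn]
  refine Finset.sum_eq_zero fun j _ => ?_
  rw [congrFun h0 j, Pi.zero_apply, zero_mul]

/-- Representatives in `(0, 1]`, since the series of the Hurwitz zeta function of frequency `0` has
its first nonzero term at `1`. -/
lemma exists_mem_Ioc_coe_eq (x : UnitAddCircle) :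
    ∃ y : ℝ, (0 < y ∧ y ≤ 1) ∧ (y : UnitAddCircle) = x := by
  obtain ⟨r, rfl⟩ := QuotientAddGroup.mk_surjective x
  have h := toIocMod_mem_Ioc (one_pos (α := ℝ)) 0 r
  rw [zero_add] at h
  refine ⟨toIocMod one_pos 0 r, ⟨h.1, h.2⟩, ?_⟩
  rw [toIocMod]
  simp

/-- The continuation of the twist: a combination of periodic zeta functions at the frequencies
`j / N - α`, in the shifted variable `s - iθ`. -/
noncomputable def periodicTwist {N : ℕ} [NeZero N] (ψ : ZMod N → ℂ) (θ α : ℝ) (s : ℂ) : ℂ :=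
  ∑ j, ψ j * HurwitzZeta.expZeta (ZMod.toAddCircle j - (α : UnitAddCircle)) (s - I * θ)

variable {N : ℕ} [NeZero N]

lemma meromorphicOn_periodicTwist (ψ : ZMod N → ℂ) (θ α : ℝ) :
    MeromorphicOn (periodicTwist ψ θ α) univ := by
  intro s _
  unfold periodicTwist
  refine MeromorphicAt.fun_sum fun j _ => (MeromorphicAt.const _ _).fun_mul ?_
  exact (meromorphicAt_expZeta _ (s - I * θ)).comp_analyticAt
    (g := fun s => s - I * θ) (by fun_prop)

lemma periodicTwist_eq_LSeries {a : ℕ → ℂ} {ψ : ZMod N → ℂ} {θ : ℝ}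
    (ha : ∀ n : ℕ, n ≠ 0 → a n * Complex.exp (-(I * θ) * Real.log n) =
      ∑ j, ψ j * ZMod.stdAddChar (j * (n : ZMod N))) (α : ℝ) {s : ℂ} (hs : 1 < s.re) :
    periodicTwist ψ θ α s = LSeries (twistCoeff a α) s := by
  have hs' : 1 < (s - I * θ).re := by simpa using hs
  have h1 : ∀ j : ZMod N, HasSum (fun n : ℕ => ψ j *
      (Complex.exp (2 * Real.pi * I * ((j.val / N - α : ℝ) : ℂ) * n) / (n : ℂ) ^ (s - I * θ)))
      (ψ j * HurwitzZeta.expZeta (ZMod.toAddCircle j - (α : UnitAddCircle)) (s - I * θ)) := by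
    intro j
    rw [ZMod.toAddCircle_apply, ← AddCircle.coe_sub]
    exact (HurwitzZeta.hasSum_expZeta_of_one_lt_re _ hs').mul_left _
  have h2 := hasSum_sum (s := Finset.univ) fun j _ => h1 j
  rw [periodicTwist, ← h2.tsum_eq, LSeries]
  refine tsum_congr fun n => ?_
  rcases eq_or_ne n 0 with rfl | hn
  · have : s - I * θ ≠ 0 := fun h => by rw [h] at hs'; norm_num at hs'
    simp [Complex.zero_cpow this]
  · have hnc : (n : ℂ) ≠ 0 := by exact_mod_cast hn
    have hNc : (N : ℂ) ≠ 0 := by exact_mod_cast NeZero.ne N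
    have hterm : ∀ j : ZMod N, ψ j * (Complex.exp (2 * Real.pi * I *
        ((j.val / N - α : ℝ) : ℂ) * n) / (n : ℂ) ^ (s - I * θ)) =
        (ψ j * ZMod.stdAddChar (j * (n : ZMod N))) *
          (Complex.exp (2 * Real.pi * I * (-(n : ℂ) * α)) / (n : ℂ) ^ (s - I * θ)) := by
      intro j
      have hst : ZMod.stdAddChar (j * (n : ZMod N)) =
          Complex.exp (2 * Real.pi * I * (j.val * n : ℕ) / N) := by
        have : j * (n : ZMod N) = (((j.val * n : ℕ) : ℤ) : ZMod N) := by
          push_cast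
          rw [ZMod.natCast_zmod_val]
        rw [this, ZMod.stdAddChar_coe]
        push_cast
        rfl
      have hadd : Complex.exp (2 * Real.pi * I * ((j.val / N - α : ℝ) : ℂ) * n) =
          Complex.exp (2 * Real.pi * I * (j.val * n : ℕ) / N) *
            Complex.exp (2 * Real.pi * I * (-(n : ℂ) * α)) := by
        rw [← Complex.exp_add]
        congr 1
        push_cast
        field_simp
        ring
      rw [hst, hadd]
      ring
    rw [Finset.sum_congr rfl fun j _ => hterm j, ← Finset.sum_mul, ← ha n hn,
      LSeries.term_of_ne_zero hn, twistCoeff, Complex.cpow_sub _ _ hnc,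
      Complex.cpow_def_of_ne_zero hnc (I * θ), neg_mul, Complex.exp_neg, Complex.natCast_log,
      mul_comm (I * (θ : ℂ))]
    have := Complex.exp_ne_zero (Complex.log n * (I * θ))
    field_simp

/-- The functional equation of the twist relates it to two combinations of Hurwitz zeta functions. -/
lemma periodicTwist_one_sub (ψ : ZMod N → ℂ) (θ α : ℝ) {w : ℂ} (hw : 1 < w.re) :
    periodicTwist ψ θ α (1 + I * θ - w) = (2 * Real.pi) ^ (-w) * Complex.Gamma w *
      (Complex.exp (Real.pi * I * w / 2) * (∑ j, ψ j *
          HurwitzZeta.hurwitzZeta (ZMod.toAddCircle j - (α : UnitAddCircle)) w) +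
        Complex.exp (-Real.pi * I * w / 2) * (∑ j, ψ j *
          HurwitzZeta.hurwitzZeta (-(ZMod.toAddCircle j - (α : UnitAddCircle))) w)) := by
  have hne : ∀ n : ℕ, w ≠ 1 - n := fun n h => by
    rw [h] at hw
    simp at hw
    have : (0 : ℝ) ≤ n := n.cast_nonneg
    linarith
  rw [periodicTwist, show 1 + I * (θ : ℂ) - w - I * θ = 1 - w by ring]
  simp only [HurwitzZeta.expZeta_one_sub _ hne]
  rw [Finset.mul_sum, Finset.mul_sum, ← Finset.sum_add_distrib, Finset.mul_sum]
  refine Finset.sum_congr rfl fun j _ => ?_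
  ring

lemma exists_isExpSmall_sum_hurwitzZeta_of_injective {ι : Type*} [Fintype ι]
    {x : ι → UnitAddCircle} (hx : Function.Injective x) {ψ : ι → ℂ} (hψ : ψ ≠ 0) :
    ∃ (y : ℝ) (C : ℂ), 0 < y ∧ C ≠ 0 ∧ IsExpSmall fun w =>
      (∑ i, ψ i * HurwitzZeta.hurwitzZeta (x i) w) * Complex.exp (w * Real.log y) / C - 1 := by
  choose y hy hyx using fun i => exists_mem_Ioc_coe_eq (x i)
  have hinj : Function.Injective y := fun i j h => hx (by rw [← hyx i, ← hyx j, h])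
  simpa only [hyx] using exists_isExpSmall_sum_hurwitzZeta hy hinj hψ

/-- The zeros of the twist far to the left. The centres are the points `s = 1 + iθ - w` with
`exp (Λ w + k) = 1`, where the two main terms of the functional equation cancel. Relative errors of
size `ρ ^ X`, where `X = -Re s` at the centre, are smaller than the radius `η ^ X` of the discs for `η = √ρ`. The
progression starts at an index `h₀` from which on this difference absorbs all constants. -/
theorem exists_zeros_periodicTwist {ψ : ZMod N → ℂ} (hψ : ψ ≠ 0) (θ α : ℝ) :
    ∃ (A B : ℂ) (η : ℝ), A.re < 0 ∧ B.re < 0 ∧ 0 < η ∧ η < 1 ∧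
      ∀ h : ℕ, HasExactlyOneZeroInside (periodicTwist ψ θ α) (A * (h : ℂ) + B)
        (η ^ (-(A * (h : ℂ) + B).re)) := by
  set v : ZMod N → UnitAddCircle := fun j => ZMod.toAddCircle j - (α : UnitAddCircle) with hv
  have hvinj : Function.Injective v := fun i j h =>
    ZMod.toAddCircle_injective N (sub_left_injective h)
  obtain ⟨x, C₁, hx, hC₁, hr₁⟩ := exists_isExpSmall_sum_hurwitzZeta_of_injective hvinj hψ
  obtain ⟨y, C₂, hy, hC₂, hr₂⟩ := exists_isExpSmall_sum_hurwitzZeta_of_injective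
    (x := fun j => -v j) (neg_injective.comp hvinj) hψ
  obtain ⟨ρ, K, hρ, hρ1, hK, hr⟩ := hr₁.common hr₂
  set D₁ : ℂ → ℂ := fun w => ∑ j, ψ j * HurwitzZeta.hurwitzZeta (v j) w with hD₁
  set D₂ : ℂ → ℂ := fun w => ∑ j, ψ j * HurwitzZeta.hurwitzZeta (-v j) w with hD₂
  set r₁ : ℂ → ℂ := fun w => D₁ w * Complex.exp (w * Real.log x) / C₁ - 1 with hr₁def
  set r₂ : ℂ → ℂ := fun w => D₂ w * Complex.exp (w * Real.log y) / C₂ - 1 with hr₂def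
  -- the ratio of the two main terms is `-exp (Λ w + k)`
  set Λ : ℂ := Real.pi * I - Real.log x + Real.log y with hΛdef
  have hΛim : Λ.im = Real.pi := by simp [hΛdef]
  have hΛ : Λ ≠ 0 := fun h => Real.pi_ne_zero (by rw [← hΛim, h]; simp)
  set k : ℂ := Complex.log (-(C₁ / C₂)) with hk
  have hexpk : Complex.exp k = -(C₁ / C₂) :=
    Complex.exp_log (neg_ne_zero.2 (div_ne_zero hC₁ hC₂))
  obtain ⟨r, κ, hr0, hκ, hone⟩ := exists_hasExactlyOneZeroInside_exp_sub_one_add (neg_ne_zero.2 hΛ)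
  set K' : ℝ := (Real.exp ‖Λ‖ + 1) * K with hK'
  have hK'0 : 0 ≤ K' := by positivity
  set η : ℝ := √ρ with hη
  have hη0 : 0 < η := Real.sqrt_pos.2 hρ
  have hη1 : η < 1 := by rw [hη, Real.sqrt_lt' one_pos]; simpa using hρ1
  have hη2 : ∀ X : ℝ, ρ ^ X = η ^ X * η ^ X := fun X => by
    rw [← Real.mul_rpow hη0.le hη0.le, hη, Real.mul_self_sqrt hρ.le]
  -- the abscissa beyond which the error terms are small enough
  obtain ⟨X₀, hX₀⟩ : ∃ X₀ : ℝ, ∀ X, X₀ ≤ X → 2 ≤ X ∧ η ^ X ≤ r ∧ K' * η ^ X ≤ κ := by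
    have h1 := tendsto_rpow_atTop_of_base_lt_one η (by linarith) hη1
    have h2 := h1.const_mul K'
    rw [mul_zero] at h2
    exact eventually_atTop.1 ((eventually_ge_atTop 2).and
      ((h1.eventually_le_const hr0).and (h2.eventually_le_const hκ)))
  have hpos : 0 < (2 * Real.pi * I / Λ).re := by
    have : (2 * Real.pi * I / Λ).re = 2 * Real.pi * Real.pi / Complex.normSq Λ := by
      rw [Complex.div_re, hΛim]
      simp
    rw [this]
    have := Complex.normSq_pos.2 hΛ
    positivity
  obtain ⟨h₀, hh₀⟩ := exists_nat_ge ((X₀ + 1 + (k / Λ).re) / (2 * Real.pi * I / Λ).re)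
  rw [div_le_iff₀ hpos] at hh₀
  set A : ℂ := -(2 * Real.pi * I / Λ) with hA
  set B : ℂ := 1 + I * θ - (h₀ * (2 * Real.pi * I / Λ) - k / Λ) with hB
  have hAre : A.re < 0 := by rw [hA, Complex.neg_re]; linarith
  have hBre : X₀ ≤ -B.re := by
    have : B.re = 1 - (h₀ * (2 * Real.pi * I / Λ).re - (k / Λ).re) := by
      rw [hB, Complex.sub_re, Complex.sub_re, ← Complex.ofReal_natCast, Complex.re_ofReal_mul]
      simp
    rw [this]
    linarith
  refine ⟨A, B, η, hAre, by linarith [(hX₀ _ hBre).1], hη0, hη1, fun h => ?_⟩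
  set c : ℂ := A * h + B with hc
  set X : ℝ := -c.re with hX
  have hXX₀ : X₀ ≤ X := by
    have : c.re = A.re * h + B.re := by
      rw [hc, Complex.add_re, ← Complex.ofReal_natCast, Complex.re_mul_ofReal]
    have hh : (0 : ℝ) ≤ h := h.cast_nonneg
    rw [hX, this]
    nlinarith
  obtain ⟨hX2, hXr, hXκ⟩ := hX₀ X hXX₀
  have hηX : 0 < η ^ X := Real.rpow_pos_of_pos hη0 X
  have hrw : ∀ s ∈ ball c 1, X ≤ (1 + I * θ - s).re := fun s hs => by
    have h1 : |(s - c).re| < 1 := (Complex.abs_re_le_norm _).trans_lt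
      (by simpa [dist_eq_norm] using hs)
    have h2 := (abs_lt.1 h1).2
    simp only [Complex.sub_re] at h2
    simp
    linarith
  have hkey : ∀ s, Λ * (1 + I * θ - s) + k =
      -Λ * (s - c) + ((h + h₀ : ℕ) : ℂ) * (2 * Real.pi * I) := fun s => by
    rw [hc, hA, hB]
    push_cast
    field_simp
    ring
  -- the error term of the perturbation
  set E : ℂ → ℂ := fun s => Complex.exp (-Λ * (s - c)) * r₁ (1 + I * θ - s) -
    r₂ (1 + I * θ - s) with hE
  have hDdiff : ∀ (u : ZMod N → UnitAddCircle) (s : ℂ), s ∈ ball c 1 → DifferentiableAt ℂ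
      (fun s => ∑ j, ψ j * HurwitzZeta.hurwitzZeta (u j) (1 + I * θ - s)) s := by
    intro u s hs
    refine DifferentiableAt.fun_sum fun j _ => DifferentiableAt.const_mul ?_ _
    refine DifferentiableAt.comp (f := fun s : ℂ => 1 + I * θ - s) s
      (HurwitzZeta.differentiableAt_hurwitzZeta _ fun h1 => ?_) (by fun_prop)
    have := hrw s hs
    rw [h1, Complex.one_re] at this
    linarith
  have hEd : DifferentiableOn ℂ E (ball c 1) := by
    intro s hs
    refine DifferentiableAt.differentiableWithinAt ?_
    refine DifferentiableAt.fun_sub (DifferentiableAt.fun_mul (by fun_prop) ?_) ?_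
    · exact (((hDdiff v s hs).fun_mul (by fun_prop)).div_const C₁).sub_const 1
    · exact (((hDdiff (fun j => -v j) s hs).fun_mul (by fun_prop)).div_const C₂).sub_const 1
  have hEb : ∀ s ∈ ball c 1, ‖E s‖ ≤ K' * ρ ^ X := by
    intro s hs
    have hre := hrw s hs
    have hsc : ‖s - c‖ ≤ 1 := by
      have : ‖s - c‖ < 1 := by simpa [dist_eq_norm] using hs
      exact this.le
    obtain ⟨b1, b2⟩ := hr (1 + I * θ - s) (hX2.trans hre)
    have hpow : ρ ^ (1 + I * θ - s).re ≤ ρ ^ X :=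
      Real.rpow_le_rpow_of_exponent_ge hρ hρ1.le hre
    have hexp : ‖Complex.exp (-Λ * (s - c))‖ ≤ Real.exp ‖Λ‖ := by
      refine (Complex.norm_exp_le_exp_norm _).trans (Real.exp_le_exp.2 ?_)
      rw [norm_mul, norm_neg]
      exact mul_le_of_le_one_right (norm_nonneg _) hsc
    calc ‖E s‖ ≤ ‖Complex.exp (-Λ * (s - c))‖ * ‖r₁ (1 + I * θ - s)‖ + ‖r₂ (1 + I * θ - s)‖ := by
          rw [← norm_mul]; exact norm_sub_le _ _
      _ ≤ Real.exp ‖Λ‖ * (K * ρ ^ X) + K * ρ ^ X := by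
          gcongr
          · exact b1.trans (by gcongr)
          · exact b2.trans (by gcongr)
      _ = _ := by rw [hK']; ring
  have hzero := hone c E (η ^ X) (K' * ρ ^ X) hEd hEb hηX hXr (by
    rw [hη2, ← mul_assoc]
    gcongr)
  have hball : ball c (η ^ X) ⊆ ball c 1 :=
    ball_subset_ball (Real.rpow_le_one hη0.le hη1.le (by linarith))
  refine hzero.mul_of_ne_zero (U := fun s => -((2 * Real.pi : ℂ) ^ (-(1 + I * θ - s)) *
    Complex.Gamma (1 + I * θ - s) * C₂ * Complex.exp (-Real.pi * I * (1 + I * θ - s) / 2) *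
      Complex.exp (-(1 + I * θ - s) * Real.log y))) ?_ ?_ ?_
  · have hpi : (2 * Real.pi : ℂ) ≠ 0 := by
      exact_mod_cast (mul_pos two_pos Real.pi_pos).ne'
    refine DifferentiableOn.analyticOnNhd (fun s hs => ?_) isOpen_ball
    refine DifferentiableAt.differentiableWithinAt (DifferentiableAt.fun_neg ?_)
    refine DifferentiableAt.fun_mul (DifferentiableAt.fun_mul (DifferentiableAt.mul_const
      (DifferentiableAt.fun_mul ?_ ?_) _) (by fun_prop)) (by fun_prop)
    · exact (by fun_prop : DifferentiableAt ℂ (fun s : ℂ => -(1 + I * θ - s)) s).const_cpow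
        (Or.inl hpi)
    · refine DifferentiableAt.comp (f := fun s : ℂ => 1 + I * θ - s) s
        (Complex.differentiableAt_Gamma _ fun m hm => ?_) (by fun_prop)
      have := hrw s (hball hs)
      rw [hm] at this
      simp at this
      have : (0 : ℝ) ≤ m := m.cast_nonneg
      linarith
  · intro s hs
    have hpi : (2 * Real.pi : ℂ) ≠ 0 := by
      exact_mod_cast (mul_pos two_pos Real.pi_pos).ne'
    have hre := hrw s (hball hs)
    refine neg_ne_zero.2 (mul_ne_zero (mul_ne_zero (mul_ne_zero (mul_ne_zero ?_ ?_) hC₂)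
      (Complex.exp_ne_zero _)) (Complex.exp_ne_zero _))
    · rw [Ne, Complex.cpow_eq_zero_iff]
      exact fun h => hpi h.1
    · exact Complex.Gamma_ne_zero_of_re_pos (by linarith)
  · intro s hs
    have hre := hrw s (hball hs)
    set w := 1 + I * θ - s with hw
    have hsw : s = 1 + I * θ - w := by rw [hw]; ring
    have hfe := periodicTwist_one_sub ψ θ α (w := w) (by linarith)
    rw [← hsw] at hfe
    have hd1 : D₁ w = C₁ * Complex.exp (-w * Real.log x) * (1 + r₁ w) := by
      simp only [hr₁def]
      rw [neg_mul, Complex.exp_neg]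
      field_simp [Complex.exp_ne_zero]
      ring
    have hd2 : D₂ w = C₂ * Complex.exp (-w * Real.log y) * (1 + r₂ w) := by
      simp only [hr₂def]
      rw [neg_mul, Complex.exp_neg]
      field_simp [Complex.exp_ne_zero]
      ring
    have hq : Complex.exp (-Λ * (s - c)) = -(C₁ / C₂) * (Complex.exp (Real.pi * I * w) *
        Complex.exp (-w * Real.log x) * Complex.exp (w * Real.log y)) := by
      have h1 := congrArg Complex.exp (hkey s)
      rw [Complex.exp_add, Complex.exp_add, Complex.exp_nat_mul_two_pi_mul_I, mul_one, hexpk] at h1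
      rw [← h1, mul_comm, ← Complex.exp_add, ← Complex.exp_add]
      congr 2
      rw [hΛdef]
      ring
    have hq1 : Complex.exp (Real.pi * I * w) * Complex.exp (-Real.pi * I * w / 2) =
        Complex.exp (Real.pi * I * w / 2) := by
      rw [← Complex.exp_add]; congr 1; ring
    have hq2 : Complex.exp (w * Real.log y) * Complex.exp (-w * Real.log y) = 1 := by
      rw [← Complex.exp_add, neg_mul, add_neg_cancel, Complex.exp_zero]
    change periodicTwist ψ θ α s = _ * (Complex.exp (-Λ * (s - c)) - 1 +
      (Complex.exp (-Λ * (s - c)) * r₁ w - r₂ w))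
    rw [hfe]
    change _ * (_ * D₁ w + _ * D₂ w) = _
    rw [hd1, hd2, hq, ← hq1]
    generalize Complex.exp (w * Real.log y) = e1 at *
    generalize Complex.exp (-w * Real.log y) = e2 at *
    generalize Complex.exp (-w * Real.log x) = e3 at *
    generalize Complex.exp (Real.pi * I * w) = e4 at *
    generalize Complex.exp (-Real.pi * I * w / 2) = e5 at *
    generalize Complex.Gamma w = e6 at *
    generalize (2 * Real.pi : ℂ) ^ (-w) = e7 at *
    have hC : C₁ / C₂ * C₂ = C₁ := div_mul_cancel₀ _ hC₂
    generalize C₁ / C₂ = e8 at *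
    rw [← hC]
    linear_combination (-(e7 * e6 * e4 * e5 * e8 * C₂ * e3 * (1 + r₁ w))) * hq2

end

theorem mainTheorem3 (F : ℂ → ℂ) (a : ℕ → ℂ) (hF : IsExtendedSelberg 1 a F) (α : ℝ) :
    ∃ G : ℂ → ℂ, IsLinearTwist a α G ∧
      ∃ (A B : ℂ) (η : ℝ), A.re < 0 ∧ B.re < 0 ∧ 0 < η ∧ η < 1 ∧
        ∀ h : ℕ, HasExactlyOneZeroInside G (A * (h : ℂ) + B)
          (η ^ (-(A * (h : ℂ) + B).re)) := by
  obtain ⟨θ, N, hN, hper⟩ := hF.exists_periodic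
  have : NeZero N := ⟨hN.ne'⟩
  obtain ⟨n₀, hn₀, han₀⟩ := hF.exists_coeff_ne_zero
  obtain ⟨ψ, hψ, hfourier⟩ := exists_fourier_of_periodic
    (c := fun n => a n * Complex.exp (-(I * θ) * Real.log n)) hper
    ⟨n₀, hn₀, mul_ne_zero han₀ (Complex.exp_ne_zero _)⟩
  exact ⟨periodicTwist ψ θ α, ⟨meromorphicOn_periodicTwist ψ θ α,
    fun s hs => periodicTwist_eq_LSeries hfourier α hs⟩, exists_zeros_periodicTwist hψ θ α⟩
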